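/- For positive integers $r,s,t$, let $K^{(r)}_{s,t}$ denote the $r$-uniform hypergraph with vertex set $X_1\cup\dots\cup X_t\cup Y$ and edge set $\{X_i\cup\{y\} : 1\le i\le t,\ y\in Y\}$, where $X_1,\dots,X_t$ are pairwise disjoint sets of size $r-1$ and $Y$ is a set of size $s$ disjoint from every $X_i$. For an $r$-uniform hypergraph $H$, let $\mathrm{ex}(n,H)$ denote the maximum number of edges in an $r$-uniform hypergraph on $n$ vertices that contains no copy of $H$ as a (not necessarily induced) subgraph. For every integer $s\ge 3$ there is an $\varepsilon=\varepsilon(s)>0$, depending only on $s$, such that for every odd integer $r\ge 3$ and every positive integer $t$, $$\mathrm{ex}\bigl(n,K^{(r)}_{s,t}\bigr)=O_{r,s,t}\Bigl(n^{\,r-\frac{1}{s-1}-\varepsilon}\Bigr)\qquad (n\to\infty),$$ where the implied constant depends only on $r$, $s$ and $t$. In fact this holds with $\varepsilon=\dfrac{1}{6(s+2)^2}$. -/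

import Mathlib

namespace Hypergraph

/-- Every edge of `H` has exactly `r` vertices. -/
def IsUniform {α : Type*} (H : Hypergraph α) (r : ℕ) : Prop :=
  ∀ e ∈ H.edgeSet, e.encard = r

/-- `G` contains a copy of `H` as a (not necessarily induced) subgraph: there is an injection of the
vertices of `H` into the vertices of `G` that sends edges of `H` to edges of `G`. -/
def IsContained {α β : Type*} (H : Hypergraph α) (G : Hypergraph β) : Prop :=
  ∃ f : H.vertexSet → β, Function.Injective f ∧ (∀ v, f v ∈ G.vertexSet) ∧
    ∀ e ∈ H.edgeSet, f '' {v | (v : α) ∈ e} ∈ G.edgeSet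

/-- The numbers of edges of the `H`-free `r`-uniform hypergraphs on `n` vertices. -/
def freeEdgeCounts {α : Type*} (r n : ℕ) (H : Hypergraph α) : Set ℕ :=
  {m | ∃ G : Hypergraph (Fin n), G.vertexSet = Set.univ ∧ G.IsUniform r ∧
    ¬ H.IsContained G ∧ G.edgeSet.ncard = m}

theorem bddAbove_freeEdgeCounts {α : Type*} (r n : ℕ) (H : Hypergraph α) :
    BddAbove (freeEdgeCounts r n H) := by
  refine ⟨(Set.univ : Set (Set (Fin n))).ncard, ?_⟩
  rintro m ⟨G, -, -, -, rfl⟩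
  exact Set.ncard_le_ncard (Set.subset_univ _) (Set.toFinite _)

/-- The Turán number `ex(n, H)` of an `r`-uniform hypergraph `H`: the maximum number of edges in an
`H`-free `r`-uniform hypergraph on `n` vertices. -/
noncomputable def turanNumber {α : Type*} (r n : ℕ) (H : Hypergraph α) : ℕ :=
  sSup (freeEdgeCounts r n H)

/-- The `r`-uniform hypergraph `K_{s,t}^{(r)}`, for positive integers `r`, `s`, `t`. Its vertex set
is the disjoint union of `t` sets `X i = {i} × Fin (r - 1)` of size `r - 1` and of `Y = Fin s`; its
edges are the sets `X i ∪ {y}`. -/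
def completeBipartiteUniform (r s t : ℕ) : Hypergraph ((Fin t × Fin (r - 1)) ⊕ Fin s) where
  vertexSet := Set.univ
  edgeSet := {e | ∃ (i : Fin t) (y : Fin s),
    e = Set.range (fun j : Fin (r - 1) => Sum.inl (i, j)) ∪ {Sum.inr y}}
  subset_vertexSet_of_mem_edgeSet' := fun _ _ => Set.subset_univ _

end Hypergraph

open Finset Function Filter

namespace TupleHypergraph

set_option linter.unusedSectionVars false

/-! ### Double counting along lines, and subsets of large minimum degree. -/

section

variable {r s : ℕ} {V : Type*} [Fintype V] [DecidableEq V]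

/-! Let H contain no copy of K. For an s-set S, the (r-1)-sets completed to edges by every vertex of
S contain no t disjoint members, so the union of a maximal disjoint family of them is a cover `c S`
with at most T = t(r-1) vertices. Encode the edges as a set G of ordered r-tuples. Then an injective
s-tuple S in the neighbourhood of f in position j always has some other entry of f in its cover;
such an entry is said to colour S. Suppose that G has about n^(r-δ) members, δ = 1/(s-1) + ε, so
that typical degrees are n^(1-δ).

By pigeonhole, in a dense part of G a single position k colours a constant proportion of the
s-tuples around position j (`exists_colored`). Each S has at most T colours, and this drives two
estimates. If two positions showed few pairs of entries, degrees in a third position would be large,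
and colouring would force even fewer pairs elsewhere. Iterating this improves the trivial lower
bound n^(2-δ) on the number of pairs to n^(2-η) with η = O(ε) (`PairsBound.step`). In turn, many
pairs imply that typically only about n^ω vertices, ω = (s-2)δ + η, share with y many of the tuples
coloured by x. This is nearly the typical degree n^(1-δ). Cutting each neighbourhood down to the
vertices close to one well-chosen member leaves almost all its s-tuples coloured by one position
p(j) (`exists_saturated`).

Saturate every position. The map p has no fixed point and r is odd, so p is not an involution, and
there is a chain j → k → l with l ≠ j. Along it, count triples of a tuple g, a vertex y close to the
k-th entry of g as seen from its l-th entry, and a j-th entry completing both g and g with y in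
position k. Saturation of k by l makes these numerous, while closeness leaves few pairs (g, y), so
by the power mean inequality the common neighbourhoods contain many s-tuples. Saturation of j by k
means that nearly all of these are coloured by y, and each has only T colours
(`saturated_chain_bound`). At ε = η = 0 the two sides differ by a factor n^(1-δ), which pays for a
positive ε. -/

/-- The vertices that complete the tuple `f` with its `i`-th entry deleted to a member of `G`. -/
def nbr (G : Finset (Fin r → V)) (i : Fin r) (f : Fin r → V) : Finset V :=
  univ.filter fun y => update f i y ∈ G

theorem mem_nbr {G : Finset (Fin r → V)} {i : Fin r} {f : Fin r → V} {y : V} :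
    y ∈ nbr G i f ↔ update f i y ∈ G := by
  simp [nbr]

theorem nbr_update (G : Finset (Fin r → V)) (i : Fin r) (f : Fin r → V) (y : V) :
    nbr G i (update f i y) = nbr G i f := by
  simp [nbr]

theorem self_mem_nbr {G : Finset (Fin r → V)} {i : Fin r} {f : Fin r → V} (hf : f ∈ G) :
    f i ∈ nbr G i f := by
  simpa [mem_nbr] using hf

theorem nbr_mono {G H : Finset (Fin r → V)} (h : G ⊆ H) (i : Fin r) (f : Fin r → V) :
    nbr G i f ⊆ nbr H i f := fun _ hy => mem_nbr.2 (h (mem_nbr.1 hy))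

/-- Exchanging the `i`-th entry with `y` is an involution on the pairs `(f, y)`. -/
theorem sum_update_swap (i : Fin r) (φ : (Fin r → V) → V → ℝ) :
    ∑ f, ∑ y, φ (update f i y) (f i) = ∑ f, ∑ y, φ f y := by
  rw [← Fintype.sum_prod_type', ← Fintype.sum_prod_type']
  have hinv : Involutive fun p : (Fin r → V) × V => (update p.1 i p.2, p.1 i) := by
    rintro ⟨f, y⟩
    simp
  exact Fintype.sum_equiv hinv.toPerm _ _ fun p => rfl

theorem sum_sum_update (i : Fin r) (φ : (Fin r → V) → ℝ) :
    ∑ f, ∑ y, φ (update f i y) = Fintype.card V * ∑ f, φ f := by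
  rw [sum_update_swap i fun f _ => φ f]
  simp [mul_sum]

/-- Lines in direction `i` are represented by full tuples whose `i`-th entry is irrelevant. Each
line is therefore counted once per vertex, which is the source of the factor `Fintype.card V`
throughout. -/
theorem sum_sum_nbr (G : Finset (Fin r → V)) (i : Fin r) (φ : (Fin r → V) → ℝ) :
    ∑ f, ∑ y ∈ nbr G i f, φ (update f i y) = Fintype.card V * ∑ f ∈ G, φ f := by
  have := sum_sum_update i fun f => if f ∈ G then φ f else 0
  simp only [sum_ite_mem, univ_inter] at this
  rw [← this]
  refine sum_congr rfl fun f _ => ?_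
  rw [nbr, sum_filter]

theorem sum_card_nbr (G : Finset (Fin r → V)) (i : Fin r) :
    ∑ f, (#(nbr G i f) : ℝ) = Fintype.card V * #G := by
  simpa using sum_sum_nbr G i fun _ => 1

theorem sum_pair {a b : Fin r} (hab : a ≠ b) (g : V → V → ℝ) :
    (Fintype.card V : ℝ) ^ 2 * ∑ f : Fin r → V, g (f a) (f b) =
      (Fintype.card V : ℝ) ^ r * ∑ x, ∑ y, g x y := by
  have h1 := sum_sum_update a fun f : Fin r → V => g (f a) (f b)
  have h2 := sum_sum_update b fun f : Fin r → V => ∑ x, g x (f b)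
  simp only [update_self, update_of_ne hab.symm] at h1 h2
  rw [pow_two, mul_assoc, ← h1, ← h2]
  rw [sum_const, card_univ, Fintype.card_fun, Fintype.card_fin, nsmul_eq_mul, Nat.cast_pow,
    sum_comm]

/-- The pairs of entries in positions `a` and `b` of the members of `G`. -/
def pairs (G : Finset (Fin r → V)) (a b : Fin r) : Finset (V × V) :=
  G.image fun f => (f a, f b)

theorem card_filter_pair {a b : Fin r} (hab : a ≠ b) (P : Finset (V × V)) :
    (Fintype.card V : ℝ) ^ 2 * #{f : Fin r → V | (f a, f b) ∈ P} =
      (Fintype.card V : ℝ) ^ r * #P := by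
  have := sum_pair hab fun x y : V => if (x, y) ∈ P then (1 : ℝ) else 0
  rw [← Fintype.sum_prod_type' (f := fun x y : V => if (x, y) ∈ P then (1 : ℝ) else 0)] at this
  simpa [sum_boole] using this

/-- `F` contains every full line through `G`, so at most `#F / Fintype.card V` lines meet `G`, and
each line of low degree contributes fewer than `d` tuples. -/
theorem card_low_degree {G F : Finset (Fin r → V)} {i : Fin r} {d : ℝ} (hd : 0 ≤ d)
    (hF : ∀ f ∈ G, ∀ y, update f i y ∈ F) :
    (Fintype.card V : ℝ) * #{f ∈ G | (#(nbr G i f) : ℝ) < d} ≤ d * #F := by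
  rw [← sum_card_nbr _ i, mul_comm, ← nsmul_eq_mul, ← sum_const, ← univ_inter F, ← sum_ite_mem]
  refine sum_le_sum fun f _ => ?_
  rcases (nbr {f ∈ G | (#(nbr G i f) : ℝ) < d} i f).eq_empty_or_nonempty with h | ⟨y, hy⟩
  · rw [h]
    split_ifs <;> simp [hd]
  · have hy' := mem_filter.1 (mem_nbr.1 hy)
    rw [nbr_update] at hy'
    have hfF : f ∈ F := by simpa using hF _ hy'.1 (f i)
    rw [if_pos hfF]
    exact le_trans (by exact_mod_cast card_le_card (nbr_mono (filter_subset _ _) i f)) hy'.2.le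

theorem nbr_filter {G : Finset (Fin r → V)} {i : Fin r} {p : (Fin r → V) → Prop}
    [DecidablePred p] (hp : ∀ f y, p (update f i y) ↔ p f) {f : Fin r → V} (hf : p f) :
    nbr (G.filter p) i f = nbr G i f := by
  ext y
  simp [mem_nbr, hp, hf]

/-- One round of deletion suffices: low degree is a property of the whole line, so removing the poor
lines leaves the degrees on the others unchanged. A small `F` allows a larger `d`. -/
theorem exists_minDegree [Nonempty V] {G F : Finset (Fin r → V)} {i : Fin r} {d : ℝ} (hd : 0 ≤ d)
    (hF : ∀ f ∈ G, ∀ y, update f i y ∈ F) (h : 2 * (d * #F) ≤ Fintype.card V * #G) :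
    ∃ G' ⊆ G, (#G : ℝ) ≤ 2 * #G' ∧ ∀ f ∈ G', d ≤ #(nbr G' i f) := by
  refine ⟨G.filter fun f => d ≤ #(nbr G i f), filter_subset _ _, ?_, fun f hf => ?_⟩
  · have hN : (0 : ℝ) < Fintype.card V := by exact_mod_cast Fintype.card_pos
    have h1 := card_low_degree hd hF
    have h2 : (#{f ∈ G | d ≤ (#(nbr G i f) : ℝ)} : ℝ) + #{f ∈ G | (#(nbr G i f) : ℝ) < d} = #G := by
      rw [← card_filter_add_card_filter_not (s := G) fun f => d ≤ (#(nbr G i f) : ℝ)]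
      simp only [not_le, Nat.cast_add]
    have h3 : (Fintype.card V : ℝ) * (2 * #{f ∈ G | (#(nbr G i f) : ℝ) < d}) ≤
        Fintype.card V * #G := by linarith
    have h4 := le_of_mul_le_mul_left h3 hN
    linarith
  · rw [nbr_filter (p := fun f => d ≤ (#(nbr G i f) : ℝ)) (fun f y => by rw [nbr_update])
      (mem_filter.1 hf).2]
    exact (mem_filter.1 hf).2

/-! ### Counting `s`-tuples inside a set. -/

/-- The `s`-tuples with entries in `W`. -/
def tup (s : ℕ) (W : Finset V) : Finset (Fin s → V) := Fintype.piFinset fun _ => W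

theorem mem_tup {W : Finset V} {S : Fin s → V} : S ∈ tup s W ↔ ∀ a, S a ∈ W := by
  simp [tup]

theorem card_tup (W : Finset V) : #(tup s W) = #W ^ s := by
  simp [tup]

theorem card_tup_filter_le (W : Finset V) (B : Finset (Fin s)) (z : Fin s → V) :
    #{S ∈ tup s W | ∀ a ∈ B, S a = z a} ≤ #W ^ (s - #B) := by
  calc #{S ∈ tup s W | ∀ a ∈ B, S a = z a}
      ≤ #(Fintype.piFinset fun a => if a ∈ B then {z a} else W) := by
        refine card_le_card fun S hS => ?_
        obtain ⟨h1, h2⟩ := mem_filter.1 hS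
        rw [Fintype.mem_piFinset]
        intro a
        split_ifs with ha
        · simp [h2 a ha]
        · exact mem_tup.1 h1 a
    _ = #W ^ (s - #B) := by
        rw [Fintype.card_piFinset]
        have : ∀ a, #(if a ∈ B then {z a} else W) = if a ∈ B then 1 else #W := fun a => by
          split_ifs <;> simp
        simp only [this]
        rw [prod_ite]
        simp [filter_not, card_sdiff]

theorem card_tup_filter_one_le (W : Finset V) (a : Fin s) (y : V) :
    #{S ∈ tup s W | S a = y} ≤ #W ^ (s - 1) := by
  simpa using card_tup_filter_le W {a} fun _ => y

theorem card_tup_filter_two_le (W : Finset V) {a b : Fin s} (hab : a ≠ b) (y z : V) :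
    #{S ∈ tup s W | S a = y ∧ S b = z} ≤ #W ^ (s - 2) := by
  have := card_tup_filter_le W {a, b} fun i => if i = a then y else z
  simpa [hab, hab.symm, card_pair hab] using this

theorem card_tup_not_injective_le (hs : 2 ≤ s) (W : Finset V) :
    #{S ∈ tup s W | ¬ Injective S} ≤ s ^ 2 * #W ^ (s - 1) := by
  classical
  have h1 : {S ∈ tup s W | ¬ Injective S} ⊆ ((univ : Finset (Fin s × Fin s)).filter
      fun p => p.1 ≠ p.2).biUnion fun p => W.biUnion fun y =>
        {S ∈ tup s W | S p.1 = y ∧ S p.2 = y} := by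
    intro S hS
    obtain ⟨hSW, hS⟩ := mem_filter.1 hS
    simp only [Injective, not_forall] at hS
    obtain ⟨a, b, hab, hne⟩ := hS
    simp only [mem_biUnion, mem_filter, mem_univ, true_and]
    exact ⟨(a, b), hne, S a, mem_tup.1 hSW a, hSW, rfl, hab.symm⟩
  refine (card_le_card h1).trans ?_
  calc _ ≤ #((univ : Finset (Fin s × Fin s)).filter fun p => p.1 ≠ p.2) * #W ^ (s - 1) := by
        refine card_biUnion_le_card_mul _ _ _ fun p hp => ?_
        have : #W ^ (s - 1) = #W * #W ^ (s - 2) := by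
          rw [← pow_succ']; congr 1; omega
        rw [this]
        exact card_biUnion_le_card_mul _ _ _ fun y _ =>
          card_tup_filter_two_le W (mem_filter.1 hp).2 y y
    _ ≤ s ^ 2 * #W ^ (s - 1) := by
        refine Nat.mul_le_mul_right _ ((card_filter_le _ _).trans ?_)
        simp [pow_two]

theorem half_card_tup_le (hs : 2 ≤ s) {W : Finset V} (hW : 2 * s ^ 2 ≤ #W) :
    (#W : ℝ) ^ s / 2 ≤ #{S ∈ tup s W | Injective S} := by
  have h1 := card_tup_not_injective_le hs W
  have h2 := card_filter_add_card_filter_not (s := tup s W) fun S => Injective S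
  rw [card_tup] at h2
  have h3 : 2 * (s ^ 2 * #W ^ (s - 1)) ≤ #W ^ s := by
    calc 2 * (s ^ 2 * #W ^ (s - 1)) = 2 * s ^ 2 * #W ^ (s - 1) := by ring
      _ ≤ #W * #W ^ (s - 1) := Nat.mul_le_mul_right _ hW
      _ = #W ^ s := by rw [← pow_succ']; congr 1; omega
  have h4 : #W ^ s ≤ 2 * #{S ∈ tup s W | Injective S} := by omega
  have h5 : (#W : ℝ) ^ s ≤ 2 * #{S ∈ tup s W | Injective S} := by exact_mod_cast h4
  linarith

/-- If a set of size at least `α F #K` is mapped to `K` with fibres of size at most `F`, then many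
points of `K` have a fibre of size at least `α F / 2`. -/
theorem card_large_fiber_le {ι κ : Type*} [DecidableEq κ] {A : Finset ι} {K : Finset κ} {p : ι → κ}
    (hp : ∀ a ∈ A, p a ∈ K) {F α : ℝ} (hF : 0 < F) (hfib : ∀ k ∈ K, (#{a ∈ A | p a = k} : ℝ) ≤ F)
    (hA : α * F * #K ≤ #A) (hα : 0 ≤ α) :
    α / 2 * #K ≤ #{k ∈ K | α / 2 * F ≤ #{a ∈ A | p a = k}} := by
  have h1 : (#A : ℝ) = ∑ k ∈ K, (#{a ∈ A | p a = k} : ℝ) := by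
    exact_mod_cast card_eq_sum_card_fiberwise hp
  have h2 : ∑ k ∈ K, (#{a ∈ A | p a = k} : ℝ) ≤
      ∑ k ∈ K, (α / 2 * F + if α / 2 * F ≤ #{a ∈ A | p a = k} then F else 0) := by
    refine sum_le_sum fun k hk => ?_
    split_ifs with h
    · have := hfib k hk
      have : 0 ≤ α / 2 * F := by positivity
      linarith
    · push Not at h
      linarith
  rw [sum_add_distrib, sum_const, nsmul_eq_mul, ← sum_filter, sum_const, nsmul_eq_mul] at h2
  have h3 : F * (α / 2 * #K) ≤ F * #{k ∈ K | α / 2 * F ≤ #{a ∈ A | p a = k}} := by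
    nlinarith
  exact le_of_mul_le_mul_left h3 hF

end

/-! ### Colouring `s`-tuples by their covers. -/

section

variable {r s T : ℕ} {V : Type*} [Fintype V] [DecidableEq V] {c : Finset V → Finset V}

/-- The tuple `S` has distinct entries, and `x` lies in the cover that `c` assigns to them. -/
def Colored (c : Finset V → Finset V) (S : Fin s → V) (x : V) : Prop :=
  Injective S ∧ x ∈ c (univ.image S)

instance (S : Fin s → V) (x : V) : Decidable (Colored c S x) :=
  inferInstanceAs (Decidable (_ ∧ _))

/-- For each set `S` of `s` vertices, `c S` meets every tuple that is completed to a member of `G`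
by all the vertices of `S`. -/
def Covered (s : ℕ) (c : Finset V → Finset V) (G : Finset (Fin r → V)) : Prop :=
  ∀ (i : Fin r) (f : Fin r → V) (S : Fin s → V), Injective S → (∀ a, update f i (S a) ∈ G) →
    ∃ j, j ≠ i ∧ f j ∈ c (univ.image S)

theorem Covered.mono {G H : Finset (Fin r → V)} (hH : Covered s c H) (h : G ⊆ H) :
    Covered s c G := fun i f S hS hf => hH i f S hS fun a => h (hf a)

/-- Double count the coloured pairs `(S, x)`: each `S` has at most `T` colours, and distinct members
of `P` account for disjoint families of such pairs. -/
theorem card_colored_le (hc : ∀ S, #(c S) ≤ T) {κ : Type*} [DecidableEq κ] (p : (Fin s → V) → κ)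
    (P : Finset (κ × V)) {h : ℝ} (hP : ∀ q ∈ P, h ≤ #{S : Fin s → V | Colored c S q.2 ∧ p S = q.1}) :
    h * #P ≤ T * (Fintype.card V : ℝ) ^ s := by
  let A : Finset ((Fin s → V) × V) := univ.filter fun q => Colored c q.1 q.2
  have h1 : #A ≤ T * Fintype.card V ^ s := by
    have : #A = ∑ S : Fin s → V, #{x | Colored c S x} := by
      simp only [A, card_filter]
      exact Fintype.sum_prod_type _
    rw [this]
    calc _ ≤ ∑ _S : Fin s → V, T := by
          refine sum_le_sum fun S _ => (card_le_card fun x hx => ?_).trans (hc (univ.image S))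
          exact (mem_filter.1 hx).2.2
      _ = T * Fintype.card V ^ s := by simp [mul_comm]
  have h2 : ∑ q ∈ P, #{S : Fin s → V | Colored c S q.2 ∧ p S = q.1} ≤ #A := by
    have : ∀ q ∈ P, #{S : Fin s → V | Colored c S q.2 ∧ p S = q.1} ≤
        #{a ∈ A | (p a.1, a.2) = q} := by
      intro q _
      refine card_le_card_of_injOn (fun S => (S, q.2)) ?_ ?_
      · intro S hS
        have := (mem_filter.1 hS).2
        simp [A, this.1, this.2]
      · intro S _ S' _ h
        exact (Prod.mk.inj h).1
    refine (sum_le_sum this).trans ?_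
    rw [← card_biUnion]
    · exact card_le_card (biUnion_subset.2 fun q _ => filter_subset _ _)
    · intro q _ q' _ hqq
      refine disjoint_filter.2 fun a _ h h' => hqq (h.symm.trans h')
  calc h * #P = ∑ _q ∈ P, h := by simp [mul_comm]
    _ ≤ ∑ q ∈ P, (#{S : Fin s → V | Colored c S q.2 ∧ p S = q.1} : ℝ) := sum_le_sum hP
    _ ≤ T * (Fintype.card V : ℝ) ^ s := by exact_mod_cast h2.trans h1

/-- Two pigeonholes over the positions other than `j`: first for each tuple, whose neighbourhood has
at least half of its `s`-tuples injective and hence covered, then for the most popular position. -/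
theorem exists_colored [Nonempty V] (hs : 2 ≤ s) {G F : Finset (Fin r → V)} (hne : G.Nonempty)
    {j : Fin r} {d : ℝ} (hd : 2 * (s : ℝ) ^ 2 ≤ d) (hG : Covered s c G)
    (hF : ∀ f ∈ G, ∀ y, update f j y ∈ F) (h : 2 * (d * #F) ≤ Fintype.card V * #G) :
    ∃ k, k ≠ j ∧ ∃ G' ⊆ G, (#G : ℝ) ≤ 2 * r * #G' ∧ ∀ f ∈ G', d ≤ #(nbr G' j f) ∧
      1 / (2 * r) * (#(nbr G' j f) : ℝ) ^ s ≤ #{S ∈ tup s (nbr G' j f) | Colored c S (f k)} := by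
  have hr : (0 : ℝ) < r := by exact_mod_cast j.pos
  obtain ⟨G₁, hG₁, hcard, hdeg⟩ := exists_minDegree (le_trans (by positivity) hd) hF h
  have hG0 : (0 : ℝ) < #G := by exact_mod_cast hne.card_pos
  let Q : Fin r → (Fin r → V) → Prop := fun k f =>
    1 / (2 * r) * (#(nbr G₁ j f) : ℝ) ^ s ≤ #{S ∈ tup s (nbr G₁ j f) | Colored c S (f k)}
  have hcover : ∀ f ∈ G₁, ∃ k, k ≠ j ∧ Q k f := by
    intro f hf
    by_contra! hcon
    have hW : 2 * s ^ 2 ≤ #(nbr G₁ j f) := by exact_mod_cast hd.trans (hdeg f hf)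
    have h1 := half_card_tup_le hs hW
    have h2 : #{S ∈ tup s (nbr G₁ j f) | Injective S} ≤
        ∑ k ∈ univ.erase j, #{S ∈ tup s (nbr G₁ j f) | Colored c S (f k)} := by
      refine le_trans (card_le_card ?_) card_biUnion_le
      intro S hS
      obtain ⟨hSW, hSi⟩ := mem_filter.1 hS
      obtain ⟨k, hk, hkc⟩ := hG j f S hSi fun a => hG₁ (mem_nbr.1 (mem_tup.1 hSW a))
      exact mem_biUnion.2 ⟨k, by simp [hk], mem_filter.2 ⟨hSW, hSi, hkc⟩⟩
    have h3 : (#{S ∈ tup s (nbr G₁ j f) | Injective S} : ℝ) ≤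
        ∑ k ∈ univ.erase j, (#{S ∈ tup s (nbr G₁ j f) | Colored c S (f k)} : ℝ) := by
      exact_mod_cast h2
    have h4 : ∑ k ∈ univ.erase j, (#{S ∈ tup s (nbr G₁ j f) | Colored c S (f k)} : ℝ) ≤
        ∑ _k ∈ univ.erase j, 1 / (2 * r) * (#(nbr G₁ j f) : ℝ) ^ s :=
      sum_le_sum fun k hk => (not_le.1 (hcon k (ne_of_mem_erase hk))).le
    rw [sum_const, nsmul_eq_mul, card_erase_of_mem (mem_univ j), card_univ, Fintype.card_fin,
      Nat.cast_sub j.pos] at h4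
    have hWpos : (0 : ℝ) < (#(nbr G₁ j f) : ℝ) ^ s := by
      have : 0 < #(nbr G₁ j f) := card_pos.2 ⟨_, self_mem_nbr hf⟩
      positivity
    -- Only `r - 1` positions compete for a proportion 1/2, so the threshold `1 / (2 * r)` leaves a
    -- strict inequality.
    have h5 : ((r : ℝ) - (1 : ℕ)) * (1 / (2 * r) * (#(nbr G₁ j f) : ℝ) ^ s) <
        (#(nbr G₁ j f) : ℝ) ^ s / 2 := by
      have : (r : ℝ) * (1 / (2 * r) * (#(nbr G₁ j f) : ℝ) ^ s) = (#(nbr G₁ j f) : ℝ) ^ s / 2 := by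
        field_simp
      rw [← this, sub_mul]
      have : 0 < 1 / (2 * r) * (#(nbr G₁ j f) : ℝ) ^ s := by positivity
      push_cast
      linarith
    linarith
  have hpop : ∃ k, k ≠ j ∧ (#G₁ : ℝ) ≤ r * #{f ∈ G₁ | Q k f} := by
    by_contra! hcon
    have h1 : #G₁ ≤ ∑ k ∈ univ.erase j, #{f ∈ G₁ | Q k f} := by
      refine le_trans (card_le_card ?_) card_biUnion_le
      intro f hf
      obtain ⟨k, hk, hQ⟩ := hcover f hf
      exact mem_biUnion.2 ⟨k, by simp [hk], mem_filter.2 ⟨hf, hQ⟩⟩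
    have h2 : (#G₁ : ℝ) ≤ ∑ k ∈ univ.erase j, (#{f ∈ G₁ | Q k f} : ℝ) := by exact_mod_cast h1
    have h3 : ∑ k ∈ univ.erase j, (#{f ∈ G₁ | Q k f} : ℝ) ≤ ∑ _k ∈ univ.erase j, (#G₁ : ℝ) / r :=
      sum_le_sum fun k hk => by
        rw [le_div_iff₀ hr, mul_comm]
        exact (hcon k (ne_of_mem_erase hk)).le
    rw [sum_const, nsmul_eq_mul, card_erase_of_mem (mem_univ j), card_univ, Fintype.card_fin,
      Nat.cast_sub j.pos] at h3
    have h4 : (r : ℝ) * (#G₁ / r) = #G₁ := by field_simp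
    have h5 : (0 : ℝ) < #G₁ / r := by
      have : (0 : ℝ) < #G₁ := by linarith
      positivity
    push_cast at h3
    nlinarith
  obtain ⟨k, hk, hkG⟩ := hpop
  refine ⟨k, hk, G₁.filter (Q k), (filter_subset _ _).trans hG₁, by nlinarith, fun f hf => ?_⟩
  -- Popularity depends only on the line, so filtering by it keeps whole lines and preserves the
  -- degrees.
  have hQi : ∀ f y, Q k (update f j y) ↔ Q k f := fun f y => by
    simp only [Q, nbr_update, update_of_ne hk]
  rw [nbr_filter hQi (mem_filter.1 hf).2]
  exact ⟨hdeg f (mem_filter.1 hf).1, (mem_filter.1 hf).2⟩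

/-! ### The bootstrap for pairs of positions. -/

/-- One step of the bootstrap for the numbers of pairs: few pairs in one pair of positions force
even fewer pairs in another one, in a dense part of `G`. -/
theorem exists_few_pairs [Nonempty V] (hs : 2 ≤ s) (hc : ∀ S, #(c S) ≤ T) {G : Finset (Fin r → V)}
    (hne : G.Nonempty) (hG : Covered s c G) {a b l : Fin r} (hab : a ≠ b) (hla : l ≠ a)
    (hlb : l ≠ b) {d : ℝ} (hd : 2 * (s : ℝ) ^ 2 ≤ d)
    (h : 2 * (d * ((Fintype.card V : ℝ) ^ r * #(pairs G a b))) ≤ (Fintype.card V : ℝ) ^ 3 * #G) :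
    ∃ m, m ≠ l ∧ ∃ G' ⊆ G, (#G : ℝ) ≤ 8 * r ^ 2 * #G' ∧
      d ^ (s - 1) * #(pairs G' l m) ≤ 4 * r * (T * (Fintype.card V : ℝ) ^ s) := by
  have hr : (0 : ℝ) < r := by exact_mod_cast l.pos
  have hN : (0 : ℝ) < Fintype.card V := by exact_mod_cast Fintype.card_pos
  have hd0 : 0 < d := lt_of_lt_of_le (by positivity) hd
  -- Membership in `F` ignores position `l`, and few pairs in `a`, `b` make `F` small. Hence few
  -- lines in direction `l` carry `G`, and their degrees can be taken large.
  let F : Finset (Fin r → V) := univ.filter fun f => (f a, f b) ∈ pairs G a b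
  have hF : ∀ f ∈ G, ∀ y, update f l y ∈ F := by
    intro f hf y
    simp only [F, mem_filter, mem_univ, true_and, update_of_ne hla.symm, update_of_ne hlb.symm]
    exact mem_image_of_mem _ hf
  have hcF : 2 * (d * #F) ≤ Fintype.card V * #G := by
    have h1 := card_filter_pair hab (pairs G a b)
    have h2 : (Fintype.card V : ℝ) ^ 2 * (2 * (d * #F)) ≤
        (Fintype.card V : ℝ) ^ 2 * (Fintype.card V * #G) := by
      calc _ = 2 * (d * ((Fintype.card V : ℝ) ^ 2 * #F)) := by ring
        _ ≤ _ := by rw [h1]; linarith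
    exact le_of_mul_le_mul_left h2 (by positivity)
  obtain ⟨m, hm, G₂, hG₂, hcard, hdeg⟩ := exists_colored hs hne hd hG hF hcF
  have a0 : Fin s := ⟨0, by omega⟩
  -- The pairs occurring as (entry of `S` at `a0`, colour) unusually often. Each uses up about `d ^
  -- (s - 1)` coloured tuples, so there are few of them, yet they capture a constant fraction of
  -- `G₂`.
  let P : Finset (V × V) := univ.filter fun q =>
    1 / (2 * (r : ℝ)) / 2 * d ^ (s - 1) ≤ #{S : Fin s → V | Colored c S q.2 ∧ S a0 = q.1}
  have hP := card_colored_le hc (fun S : Fin s → V => S a0) P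
    (h := 1 / (2 * (r : ℝ)) / 2 * d ^ (s - 1)) fun q hq => (mem_filter.1 hq).2
  let G₃ := G₂.filter fun f => (f l, f m) ∈ P
  have hfib : ∀ f : Fin r → V,
      1 / (2 * (r : ℝ)) / 2 * (#(nbr G₂ l f) : ℝ) ≤ #(nbr G₃ l f) := by
    intro f
    rcases (nbr G₂ l f).eq_empty_or_nonempty with he | ⟨y, hy⟩
    · simp [he]
    obtain ⟨h1, h2⟩ := hdeg _ (mem_nbr.1 hy)
    rw [nbr_update] at h1 h2
    rw [update_of_ne hm] at h2
    set W := nbr G₂ l f with hW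
    have hW0 : (0 : ℝ) < #W := by exact_mod_cast card_pos.2 ⟨y, hy⟩
    refine (card_large_fiber_le (A := {S ∈ tup s W | Colored c S (f m)}) (K := W)
      (p := fun S => S a0) (F := (#W : ℝ) ^ (s - 1)) (α := 1 / (2 * r)) ?_ (by positivity) ?_ ?_
      (by positivity)).trans ?_
    · intro S hS
      exact mem_tup.1 (mem_filter.1 hS).1 a0
    · intro y _
      refine le_trans ?_ (by exact_mod_cast card_tup_filter_one_le W a0 y :
        (#{S ∈ tup s W | S a0 = y} : ℝ) ≤ (#W : ℝ) ^ (s - 1))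
      exact_mod_cast card_le_card fun S hS => by
        simp only [mem_filter] at hS ⊢
        exact ⟨hS.1.1, hS.2⟩
    · rw [mul_assoc, ← pow_succ, Nat.sub_add_cancel (by omega)]
      exact h2
    · refine Nat.cast_le.2 (card_le_card fun y hy => ?_)
      obtain ⟨hyW, hy⟩ := mem_filter.1 hy
      rw [mem_nbr]
      refine mem_filter.2 ⟨mem_nbr.1 hyW, ?_⟩
      simp only [update_self, update_of_ne hm, P, mem_filter, mem_univ, true_and]
      calc 1 / (2 * (r : ℝ)) / 2 * d ^ (s - 1) ≤ 1 / (2 * (r : ℝ)) / 2 * (#W : ℝ) ^ (s - 1) := by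
            gcongr
        _ ≤ _ := hy
        _ ≤ _ := by
          refine Nat.cast_le.2 (card_le_card fun S hS => ?_)
          simp only [mem_filter, mem_univ, true_and] at hS ⊢
          exact ⟨hS.1.2, hS.2⟩
  have hG₃ : 1 / (2 * (r : ℝ)) / 2 * #G₂ ≤ #G₃ := by
    have := sum_le_sum fun (f : Fin r → V) (_ : f ∈ univ) => hfib f
    rw [← mul_sum, sum_card_nbr, sum_card_nbr] at this
    have h2 : (Fintype.card V : ℝ) * (1 / (2 * (r : ℝ)) / 2 * #G₂) ≤ Fintype.card V * #G₃ := by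
      linarith
    exact le_of_mul_le_mul_left h2 hN
  refine ⟨m, hm, G₃, (filter_subset _ _).trans hG₂, ?_, ?_⟩
  · have : (#G₂ : ℝ) ≤ 4 * r * #G₃ := by
      have h2 : (4 * r) * (1 / (2 * (r : ℝ)) / 2 * #G₂) ≤ 4 * r * #G₃ := by gcongr
      calc (#G₂ : ℝ) = (4 * r) * (1 / (2 * (r : ℝ)) / 2 * #G₂) := by field_simp; norm_num
        _ ≤ _ := h2
    nlinarith
  · have hsub : #(pairs G₃ l m) ≤ #P := by
      refine card_le_card fun q hq => ?_
      obtain ⟨f, hf, rfl⟩ := mem_image.1 hq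
      exact (mem_filter.1 hf).2
    have hsub' : (#(pairs G₃ l m) : ℝ) ≤ #P := by exact_mod_cast hsub
    calc d ^ (s - 1) * #(pairs G₃ l m) ≤ d ^ (s - 1) * #P := by gcongr
      _ = 4 * r * (1 / (2 * (r : ℝ)) / 2 * d ^ (s - 1) * #P) := by field_simp; norm_num
      _ ≤ _ := by gcongr

/-! ### Closeness, and saturation of one position. -/

/-- The vertices `z` such that at least `θ` tuples colored by `x` have the entries `y` and `z` in
the positions `a` and `b`. -/
noncomputable def close (c : Finset V → Finset V) (a b : Fin s) (θ : ℝ) (y x : V) : Finset V :=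
  univ.filter fun z => θ ≤ #{S : Fin s → V | Colored c S x ∧ S a = y ∧ S b = z}

theorem sum_card_close_le (hc : ∀ S, #(c S) ≤ T) (a b : Fin s) (θ : ℝ) :
    θ * ∑ y, ∑ x, (#(close c a b θ y x) : ℝ) ≤ T * (Fintype.card V : ℝ) ^ s := by
  let P : Finset ((V × V) × V) := univ.filter fun q => q.1.2 ∈ close c a b θ q.1.1 q.2
  have h1 : ∑ y, ∑ x, #(close c a b θ y x) = #P := by
    simp only [P, card_filter, Fintype.sum_prod_type, close, mem_filter, mem_univ, true_and]
    exact sum_congr rfl fun y _ => sum_comm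
  have h2 := card_colored_le hc (fun S : Fin s → V => (S a, S b)) P (h := θ) fun q hq => by
    have := (mem_filter.1 (mem_filter.1 hq).2).2
    simpa [Prod.ext_iff] using this
  have h3 : ∑ y, ∑ x, (#(close c a b θ y x) : ℝ) = #P := by exact_mod_cast h1
  rwa [h3]

theorem card_close_pairs_ge (hs : 2 ≤ s) {a b : Fin s} (hab : a ≠ b) {W : Finset V} {x : V}
    {d α : ℝ} (hd : 0 < d) (hα : 0 ≤ α) (hW : d ≤ #W)
    (h : α * (#W : ℝ) ^ s ≤ #{S ∈ tup s W | Colored c S x}) :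
    α / 2 * (#W : ℝ) ^ 2 ≤
      #{q ∈ W ×ˢ W | q.2 ∈ close c a b (α / 2 * d ^ (s - 2)) q.1 x} := by
  have hW0 : (0 : ℝ) < #W := hd.trans_le hW
  have hcard : (#(W ×ˢ W) : ℝ) = (#W : ℝ) ^ 2 := by rw [card_product]; push_cast; ring
  rw [← hcard]
  refine (card_large_fiber_le (A := {S ∈ tup s W | Colored c S x}) (K := W ×ˢ W)
    (p := fun S => (S a, S b)) (F := (#W : ℝ) ^ (s - 2)) (α := α) ?_ (by positivity) ?_ ?_
    hα).trans ?_
  · intro S hS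
    have := mem_tup.1 (mem_filter.1 hS).1
    exact mem_product.2 ⟨this a, this b⟩
  · intro q _
    refine le_trans ?_ (by exact_mod_cast card_tup_filter_two_le W hab q.1 q.2 :
      (#{S ∈ tup s W | S a = q.1 ∧ S b = q.2} : ℝ) ≤ (#W : ℝ) ^ (s - 2))
    refine Nat.cast_le.2 (card_le_card fun S hS => ?_)
    simp only [mem_filter, Prod.ext_iff] at hS ⊢
    exact ⟨hS.1.1, hS.2⟩
  · rw [hcard, mul_assoc, ← pow_add, Nat.sub_add_cancel hs]
    exact h
  · refine Nat.cast_le.2 (card_le_card fun q hq => ?_)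
    obtain ⟨hqW, hq⟩ := mem_filter.1 hq
    refine mem_filter.2 ⟨hqW, ?_⟩
    simp only [close, mem_filter, mem_univ, true_and]
    calc α / 2 * d ^ (s - 2) ≤ α / 2 * (#W : ℝ) ^ (s - 2) := by gcongr
      _ ≤ _ := hq
      _ ≤ _ := by
        refine Nat.cast_le.2 (card_le_card fun S hS => ?_)
        simp only [mem_filter, mem_univ, true_and, Prod.ext_iff] at hS ⊢
        exact ⟨hS.1.2, hS.2⟩

/-- A positive proportion of the pairs in `W` are close, so by averaging a positive proportion of
the vertices are close to a positive proportion of `W`. -/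
theorem card_central_ge (hs : 2 ≤ s) {a b : Fin s} (hab : a ≠ b) {W : Finset V} {x : V}
    {d α : ℝ} (hd : 0 < d) (hα : 0 ≤ α) (hW : d ≤ #W)
    (h : α * (#W : ℝ) ^ s ≤ #{S ∈ tup s W | Colored c S x}) :
    α / 4 * #W ≤
      #{y ∈ W | α / 4 * #W ≤ #(W ∩ close c a b (α / 2 * d ^ (s - 2)) y x)} := by
  have hW0 : (0 : ℝ) < #W := hd.trans_le hW
  have hp := card_close_pairs_ge hs hab hd hα hW h
  have h4 : α / 4 = α / 2 / 2 := by ring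
  rw [h4]
  have hfib : ∀ y ∈ W, #{q ∈ {q ∈ W ×ˢ W | q.2 ∈ close c a b (α / 2 * d ^ (s - 2)) q.1 x} |
      q.1 = y} ≤ #(W ∩ close c a b (α / 2 * d ^ (s - 2)) y x) := by
    intro y _
    refine card_le_card_of_injOn (fun q => q.2) ?_ ?_
    · rintro ⟨q₁, q₂⟩ hq
      simp only [coe_filter, mem_filter, mem_product, Set.mem_ofPred_eq] at hq
      obtain ⟨⟨hqW, hqc⟩, rfl⟩ := hq
      exact mem_coe.2 (mem_inter.2 ⟨hqW.2, hqc⟩)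
    · rintro ⟨q₁, q₂⟩ hq ⟨q₁', q₂'⟩ hq' h
      simp only [coe_filter, Set.mem_ofPred_eq] at hq hq'
      simp only at h
      rw [h, hq.2, hq'.2]
  refine (card_large_fiber_le (K := W) (p := fun q : V × V => q.1) (F := #W) (α := α / 2)
    (A := {q ∈ W ×ˢ W | q.2 ∈ close c a b (α / 2 * d ^ (s - 2)) q.1 x}) ?_ hW0 ?_ ?_
    (by positivity)).trans ?_
  · intro q hq
    exact (mem_product.1 (mem_filter.1 hq).1).1
  · intro y hy
    exact_mod_cast (hfib y hy).trans (card_le_card inter_subset_left)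
  · rw [mul_assoc, ← pow_two]
    exact hp
  · refine Nat.cast_le.2 (card_le_card fun y hy => ?_)
    obtain ⟨hyW, hy⟩ := mem_filter.1 hy
    exact mem_filter.2 ⟨hyW, hy.trans (by exact_mod_cast hfib y hyW)⟩

/-- For most members of a dense `G`, the entry in position `j` is central in the neighbourhood and
not close to too many vertices. -/
theorem exists_central [Nonempty V] (hs : 2 ≤ s) (hc : ∀ S, #(c S) ≤ T) {G : Finset (Fin r → V)}
    (hne : G.Nonempty) (hG : Covered s c G) {j : Fin r} {d Δ M : ℝ}
    (hd : 2 * (s : ℝ) ^ 2 ≤ d) (hdG : 2 * (d * (Fintype.card V : ℝ) ^ r) ≤ Fintype.card V * #G)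
    (hΔ : 0 < Δ) (hM : 4 * r * (T * (Fintype.card V : ℝ) ^ s) ≤ Δ * M * d ^ (s - 2))
    (hH : ∀ k, k ≠ j → ∀ G' ⊆ G, (#G : ℝ) ≤ 32 * r ^ 2 * #G' → M < #(pairs G' j k)) :
    ∃ k, k ≠ j ∧ ∃ G₂ ⊆ G, ∃ G₄ ⊆ G₂, ∃ C : V → V → Finset V,
      (#G : ℝ) ≤ 32 * r ^ 2 * #G₄ ∧ ∀ f ∈ G₄, (#(C (f j) (f k)) : ℝ) ≤ Δ ∧
        1 / (8 * r) * (#(nbr G₂ j f) : ℝ) ≤ #(nbr G₂ j f ∩ C (f j) (f k)) := by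
  obtain ⟨a, b, hab⟩ : ∃ a b : Fin s, a ≠ b := ⟨⟨0, by omega⟩, ⟨1, by omega⟩, by simp⟩
  have hr : (0 : ℝ) < r := by exact_mod_cast j.pos
  have hN : (0 : ℝ) < Fintype.card V := by exact_mod_cast Fintype.card_pos
  have hd0 : 0 < d := lt_of_lt_of_le (by positivity) hd
  obtain ⟨k, hk, G₂, hG₂, hcard, hdeg⟩ := exists_colored (F := univ) hs hne hd hG
    (fun _ _ _ => mem_univ _) (by simpa using hdG)
  set θ : ℝ := 1 / (2 * r) / 2 * d ^ (s - 2) with hθ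
  have hθ0 : 0 < θ := by positivity
  let Q : (Fin r → V) → Prop := fun f =>
    1 / (8 * r) * (#(nbr G₂ j f) : ℝ) ≤ #(nbr G₂ j f ∩ close c a b θ (f j) (f k))
  let A := G₂.filter Q
  have hA : 1 / (8 * (r : ℝ)) * #G₂ ≤ #A := by
    have hfib : ∀ f : Fin r → V, 1 / (8 * (r : ℝ)) * (#(nbr G₂ j f) : ℝ) ≤ #(nbr A j f) := by
      intro f
      rcases (nbr G₂ j f).eq_empty_or_nonempty with he | ⟨y, hy⟩
      · simp [he]
      obtain ⟨h1, h2⟩ := hdeg _ (mem_nbr.1 hy)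
      rw [nbr_update] at h1 h2
      rw [update_of_ne hk] at h2
      have h3 := card_central_ge hs hab hd0 (by positivity) h1 h2
      have h8 : 1 / (2 * (r : ℝ)) / 4 = 1 / (8 * r) := by field_simp; norm_num
      rw [h8] at h3
      refine h3.trans (Nat.cast_le.2 (card_le_card fun z hz => ?_))
      obtain ⟨hzW, hz⟩ := mem_filter.1 hz
      rw [mem_nbr]
      refine mem_filter.2 ⟨mem_nbr.1 hzW, ?_⟩
      simp only [Q, nbr_update, update_self, update_of_ne hk]
      exact hz
    have := sum_le_sum fun (f : Fin r → V) (_ : f ∈ univ) => hfib f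
    rw [← mul_sum, sum_card_nbr, sum_card_nbr] at this
    have h2 : (Fintype.card V : ℝ) * (1 / (8 * (r : ℝ)) * #G₂) ≤ Fintype.card V * #A := by
      linarith
    exact le_of_mul_le_mul_left h2 hN
  let light : (Fin r → V) → Prop := fun f => (#(close c a b θ (f j) (f k)) : ℝ) ≤ Δ
  -- A dense set of heavy tuples would show more than `M` pairs, each with more than `Δ` close
  -- vertices, against the total allowed by `sum_card_close_le`.
  have hheavy : (32 * r ^ 2 * #{f ∈ A | ¬ light f} : ℝ) < #G := by
    by_contra! hcon
    have h1 := hH k hk _ ((filter_subset _ _).trans ((filter_subset _ _).trans hG₂)) hcon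
    have h2 : Δ * #(pairs {f ∈ A | ¬ light f} j k) ≤ ∑ y, ∑ x, (#(close c a b θ y x) : ℝ) := by
      rw [← Fintype.sum_prod_type', mul_comm, ← nsmul_eq_mul, ← sum_const]
      refine (sum_le_sum fun q hq => ?_).trans
        (sum_le_univ_sum_of_nonneg (s := pairs {f ∈ A | ¬ light f} j k) fun q => Nat.cast_nonneg _)
      obtain ⟨f, hf, rfl⟩ := mem_image.1 hq
      exact (not_le.1 (mem_filter.1 hf).2).le
    have h3 := sum_card_close_le hc a b θ
    have h4 : θ * (Δ * #(pairs {f ∈ A | ¬ light f} j k)) ≤ T * (Fintype.card V : ℝ) ^ s :=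
      le_trans (by gcongr) h3
    have h5 : θ * (Δ * M) < θ * (Δ * #(pairs {f ∈ A | ¬ light f} j k)) := by gcongr
    have h6 : Δ * M * d ^ (s - 2) = 4 * r * (θ * (Δ * M)) := by
      rw [hθ]; field_simp; norm_num
    have h7 : 4 * (r : ℝ) * (θ * (Δ * M)) < 4 * r * (T * (Fintype.card V : ℝ) ^ s) :=
      mul_lt_mul_of_pos_left (h5.trans_le h4) (by positivity)
    linarith
  refine ⟨k, hk, G₂, hG₂, A.filter light, (filter_subset _ _).trans (filter_subset _ _),
    close c a b θ, ?_,
    fun f hf => ?_⟩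
  · have h1 : (#{f ∈ A | light f} : ℝ) + #{f ∈ A | ¬ light f} = #A := by
      exact_mod_cast card_filter_add_card_filter_not (s := A) light
    have h2 : (#G₂ : ℝ) ≤ 8 * r * #A := by
      calc (#G₂ : ℝ) = 8 * r * (1 / (8 * (r : ℝ)) * #G₂) := by field_simp
        _ ≤ _ := by gcongr
    have h3 : (#G : ℝ) ≤ 16 * r ^ 2 * #A := by
      calc (#G : ℝ) ≤ 2 * r * #G₂ := hcard
        _ ≤ 2 * r * (8 * r * #A) := by gcongr
        _ = _ := by ring
    nlinarith
  · obtain ⟨hfA, hfl⟩ := mem_filter.1 hf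
    exact ⟨hfl, (mem_filter.1 hfA).2⟩

/-- The number of pairs of a tuple `f` and an `s`-tuple in its neighbourhood in position `j` that is
not colored by the entry of `f` in position `k`; the entry of `f` in position `j` is arbitrary. -/
def defect (s : ℕ) (c : Finset V → Finset V) (G : Finset (Fin r → V)) (j k : Fin r) : ℕ :=
  ∑ f, #{S ∈ tup s (nbr G j f) | ¬ Colored c S (f k)}

theorem defect_mono {G H : Finset (Fin r → V)} (h : G ⊆ H) (j k : Fin r) :
    defect s c G j k ≤ defect s c H j k := by
  refine sum_le_sum fun f _ => card_le_card fun S hS => ?_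
  obtain ⟨h1, h2⟩ := mem_filter.1 hS
  exact mem_filter.2 ⟨mem_tup.2 fun a => nbr_mono h j f (mem_tup.1 h1 a), h2⟩

theorem tup_empty (hs : 0 < s) : tup s (∅ : Finset V) = ∅ := by
  rw [← card_eq_zero, card_tup, card_empty, zero_pow hs.ne']

/-- The vertices of a light pair see few tuples that are covered in a third position. -/
theorem sum_light_le (hc : ∀ S, #(c S) ≤ T) [Nonempty V] {k m : Fin r} (hkm : k ≠ m)
    (C : V → V → Finset V) {Δ : ℝ} (hΔ : 0 ≤ Δ) :
    ∑ f : Fin r → V, ∑ z with (#(C z (f k)) : ℝ) ≤ Δ,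
      (#{S ∈ tup s (C z (f k)) | f m ∈ c (univ.image S)} : ℝ) ≤
        (Fintype.card V : ℝ) ^ r * (T * Δ ^ s) := by
  have hN : (0 : ℝ) < Fintype.card V := by exact_mod_cast Fintype.card_pos
  have h1 := sum_pair hkm fun x w : V => ∑ z with (#(C z x) : ℝ) ≤ Δ,
      (#{S ∈ tup s (C z x) | w ∈ c (univ.image S)} : ℝ)
  have h2 : ∀ x z : V, (#(C z x) : ℝ) ≤ Δ →
      ∑ w, (#{S ∈ tup s (C z x) | w ∈ c (univ.image S)} : ℝ) ≤ T * Δ ^ s := by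
    intro x z hz
    have h3 : ∑ w, #{S ∈ tup s (C z x) | w ∈ c (univ.image S)} ≤ #(C z x) ^ s * T := by
      simp only [card_filter]
      rw [sum_comm]
      calc _ ≤ ∑ _S ∈ tup s (C z x), T := by
            refine sum_le_sum fun S _ => ?_
            rw [← card_filter]
            exact (card_le_card fun w hw => (mem_filter.1 hw).2).trans (hc (univ.image S))
        _ = _ := by rw [sum_const, card_tup, smul_eq_mul]
    calc ∑ w, (#{S ∈ tup s (C z x) | w ∈ c (univ.image S)} : ℝ) ≤ (#(C z x) : ℝ) ^ s * T := by
          exact_mod_cast h3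
      _ ≤ Δ ^ s * T := by gcongr
      _ = _ := mul_comm _ _
  have h4 : ∑ x, ∑ w, ∑ z with (#(C z x) : ℝ) ≤ Δ,
      (#{S ∈ tup s (C z x) | w ∈ c (univ.image S)} : ℝ) ≤
        (Fintype.card V : ℝ) ^ 2 * (T * Δ ^ s) := by
    calc _ ≤ ∑ _x : V, ∑ _z : V, (T * Δ ^ s) := by
          refine sum_le_sum fun x _ => ?_
          rw [sum_comm]
          refine (sum_le_sum fun z hz => h2 x z (mem_filter.1 hz).2).trans ?_
          exact sum_le_univ_sum_of_nonneg fun _ => by positivity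
      _ = _ := by simp; ring
  have h5 : (Fintype.card V : ℝ) ^ 2 * (∑ f : Fin r → V, ∑ z with (#(C z (f k)) : ℝ) ≤ Δ,
      (#{S ∈ tup s (C z (f k)) | f m ∈ c (univ.image S)} : ℝ)) ≤
      (Fintype.card V : ℝ) ^ 2 * ((Fintype.card V : ℝ) ^ r * (T * Δ ^ s)) := by
    rw [h1]
    calc _ ≤ (Fintype.card V : ℝ) ^ r * ((Fintype.card V : ℝ) ^ 2 * (T * Δ ^ s)) := by gcongr
      _ = _ := by ring
  exact le_of_mul_le_mul_left h5 (by positivity)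

/-- A dense part of `G` in which the degrees in position `j` are at most `Δ`, and in which almost
all tuples in the neighbourhoods in position `j` are colored by the entry in one position `k`. -/
theorem exists_saturated [Nonempty V] (hs : 2 ≤ s) (hc : ∀ S, #(c S) ≤ T)
    {G : Finset (Fin r → V)} (hne : G.Nonempty) (hG : Covered s c G) {j : Fin r} {d Δ M : ℝ}
    (hd : 2 * (s : ℝ) ^ 2 ≤ d) (hdG : 2 * (d * (Fintype.card V : ℝ) ^ r) ≤ Fintype.card V * #G)
    (hΔ : 0 < Δ) (hM : 4 * r * (T * (Fintype.card V : ℝ) ^ s) ≤ Δ * M * d ^ (s - 2))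
    (hH : ∀ k, k ≠ j → ∀ G' ⊆ G, (#G : ℝ) ≤ 32 * r ^ 2 * #G' → M < #(pairs G' j k)) :
    ∃ k, k ≠ j ∧ ∃ G' ⊆ G, (#G : ℝ) ≤ 512 * r ^ 3 * #G' ∧ (∀ f, (#(nbr G' j f) : ℝ) ≤ Δ) ∧
      (defect s c G' j k : ℝ) ≤
        (Fintype.card V : ℝ) ^ r * (32 * r ^ 3 * T * Δ ^ s / d + s ^ 2 * Δ ^ (s - 1)) := by
  classical
  have hr : (0 : ℝ) < r := by exact_mod_cast j.pos
  have hN : (0 : ℝ) < Fintype.card V := by exact_mod_cast Fintype.card_pos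
  have hd0 : 0 < d := lt_of_lt_of_le (by positivity) hd
  obtain ⟨k, hk, G₂, hG₂, G₄, hG₄, C, hcard, hcen⟩ :=
    exists_central hs hc hne hG hd hdG hΔ hM hH
  set d' : ℝ := d / (32 * r ^ 2) with hd'
  have hd'0 : 0 < d' := by positivity
  obtain ⟨G₅, hG₅, hcard₅, hdeg₅⟩ := exists_minDegree (G := G₄) (F := univ) (i := j) hd'0.le
    (fun _ _ _ => mem_univ _) (by
      rw [card_univ, Fintype.card_fun, Fintype.card_fin, Nat.cast_pow, hd']
      have h1 : (Fintype.card V : ℝ) * #G ≤ Fintype.card V * (32 * r ^ 2 * #G₄) := by gcongr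
      have h2 := hdG.trans h1
      have h3 : 2 * (d / (32 * r ^ 2) * (Fintype.card V : ℝ) ^ r) =
        2 * (d * (Fintype.card V : ℝ) ^ r) / (32 * r ^ 2) := by ring
      rw [h3, div_le_iff₀ (by positivity)]
      linarith)
  -- Tuples covered by a third position. The set `C y (f k)` does not depend on the third entry, and
  -- each tuple has at most `T` colours, so averaging over that entry shows that bad tuples are
  -- rare.
  let bad : (Fin r → V) → V → ℕ := fun f y =>
    #{S ∈ tup s (nbr G₂ j f ∩ C y (f k)) | ∃ m, m ≠ j ∧ m ≠ k ∧ f m ∈ c (univ.image S)}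
  have hbadi : ∀ f y z, bad (update f j z) y = bad f y := by
    intro f y z
    simp only [bad, nbr_update, update_of_ne hk]
    congr 1
    refine filter_congr fun S _ => ?_
    refine exists_congr fun m => ?_
    constructor
    · rintro ⟨h1, h2, h3⟩
      exact ⟨h1, h2, by rwa [update_of_ne h1] at h3⟩
    · rintro ⟨h1, h2, h3⟩
      exact ⟨h1, h2, by rwa [update_of_ne h1]⟩
  have hch : ∀ f, ∃ y, (nbr G₅ j f).Nonempty → y ∈ nbr G₅ j f ∧
      d' * bad f y ≤ ∑ z ∈ nbr G₅ j f, (bad f z : ℝ) := by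
    intro f
    by_cases hf : (nbr G₅ j f).Nonempty
    · obtain ⟨y, hy, hmin⟩ := exists_min_image (nbr G₅ j f) (bad f) hf
      refine ⟨y, fun _ => ⟨hy, ?_⟩⟩
      have h1 := hdeg₅ _ (mem_nbr.1 hy)
      rw [nbr_update] at h1
      calc d' * bad f y ≤ #(nbr G₅ j f) * (bad f y : ℝ) := by gcongr
        _ = ∑ z ∈ nbr G₅ j f, (bad f y : ℝ) := by rw [sum_const, nsmul_eq_mul]
        _ ≤ _ := sum_le_sum fun z hz => by exact_mod_cast hmin z hz
    · exact ⟨Classical.arbitrary V, fun h => absurd h hf⟩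
  choose Y hY using hch
  -- Normalising the `j`-th entry makes the chosen centre a function of the line alone.
  let y₀ : (Fin r → V) → V := fun f => Y (update f j (Classical.arbitrary V))
  have hy₀i : ∀ f z, y₀ (update f j z) = y₀ f := fun f z => by simp [y₀]
  have hy₀ : ∀ f, (nbr G₅ j f).Nonempty → y₀ f ∈ nbr G₅ j f ∧
      d' * bad f (y₀ f) ≤ ∑ z ∈ nbr G₅ j f, (bad f z : ℝ) := by
    intro f hf
    have := hY (update f j (Classical.arbitrary V)) (by rwa [nbr_update])
    simpa only [nbr_update, hbadi] using this
  have hcen' : ∀ f, ∀ y ∈ nbr G₅ j f, (#(C y (f k)) : ℝ) ≤ Δ ∧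
      1 / (8 * r) * (#(nbr G₂ j f) : ℝ) ≤ #(nbr G₂ j f ∩ C y (f k)) := by
    intro f y hy
    have := hcen _ (hG₅ (mem_nbr.1 hy))
    simpa only [nbr_update, update_self, update_of_ne hk] using this
  -- On each line, keep only the vertices close to its centre. Lightness bounds the new degrees by
  -- `Δ`, and centrality keeps a constant fraction.
  let G' := G₂.filter fun f => (nbr G₅ j f).Nonempty ∧ f j ∈ C (y₀ f) (f k)
  have hnbr : ∀ f, nbr G' j f =
      if (nbr G₅ j f).Nonempty then nbr G₂ j f ∩ C (y₀ f) (f k) else ∅ := by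
    intro f
    ext z
    rw [mem_nbr]
    simp only [G', mem_filter, nbr_update, update_self, update_of_ne hk, hy₀i, ← mem_nbr]
    split_ifs with h
    · simp [h]
    · simp [h]
  have hdegle : ∀ f, (#(nbr G' j f) : ℝ) ≤ Δ := by
    intro f
    rw [hnbr]
    split_ifs with h
    · exact le_trans (by exact_mod_cast card_le_card inter_subset_right)
        (hcen' f _ (hy₀ f h).1).1
    · simpa using hΔ.le
  have hG'G : G' ⊆ G := (filter_subset _ _).trans hG₂
  refine ⟨k, hk, G', hG'G, ?_, hdegle, ?_⟩
  · have h1 : ∀ f, 1 / (8 * (r : ℝ)) * (#(nbr G₅ j f) : ℝ) ≤ #(nbr G' j f) := by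
      intro f
      rw [hnbr]
      split_ifs with h
      · refine le_trans ?_ (hcen' f _ (hy₀ f h).1).2
        have : #(nbr G₅ j f) ≤ #(nbr G₂ j f) := card_le_card (nbr_mono (hG₅.trans hG₄) j f)
        gcongr
      · rw [not_nonempty_iff_eq_empty] at h
        simp [h]
    have h2 := sum_le_sum fun (f : Fin r → V) (_ : f ∈ univ) => h1 f
    rw [← mul_sum, sum_card_nbr, sum_card_nbr] at h2
    have h3 : (Fintype.card V : ℝ) * (1 / (8 * (r : ℝ)) * #G₅) ≤ Fintype.card V * #G' := by
      linarith
    have h4 := le_of_mul_le_mul_left h3 hN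
    calc (#G : ℝ) ≤ 32 * r ^ 2 * #G₄ := hcard
      _ ≤ 32 * r ^ 2 * (2 * #G₅) := by gcongr
      _ = 512 * r ^ 3 * (1 / (8 * (r : ℝ)) * #G₅) := by field_simp; ring
      _ ≤ _ := by gcongr
  · have h1 : ∀ f, (#{S ∈ tup s (nbr G' j f) | ¬ Colored c S (f k)} : ℝ) ≤
        s ^ 2 * Δ ^ (s - 1) + ∑ m ∈ univ.filter fun m => m ≠ j ∧ m ≠ k,
          1 / d' * ∑ z with (#(C z (f k)) : ℝ) ≤ Δ,
            (#{S ∈ tup s (C z (f k)) | f m ∈ c (univ.image S)} : ℝ) := by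
      intro f
      by_cases hf : (nbr G₅ j f).Nonempty
      swap
      · rw [hnbr, if_neg hf]
        rw [tup_empty (by omega), filter_empty, card_empty, Nat.cast_zero]
        have h0 : 0 ≤ (s : ℝ) ^ 2 * Δ ^ (s - 1) := by positivity
        exact add_nonneg h0 (sum_nonneg fun m _ => mul_nonneg (one_div_pos.2 hd'0).le
          (sum_nonneg fun z _ => Nat.cast_nonneg _))
      have h2 : #{S ∈ tup s (nbr G' j f) | ¬ Colored c S (f k)} ≤
          #{S ∈ tup s (nbr G' j f) | ¬ Injective S} + bad f (y₀ f) := by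
        refine le_trans (card_le_card ?_) (card_union_le _ _)
        intro S hS
        obtain ⟨hSW, hS⟩ := mem_filter.1 hS
        by_cases hi : Injective S
        · refine mem_union_right _ (mem_filter.2 ⟨?_, ?_⟩)
          · rwa [hnbr, if_pos hf] at hSW
          · obtain ⟨m, hm, hmc⟩ := hG j f S hi fun a => hG'G (mem_nbr.1 (mem_tup.1 hSW a))
            refine ⟨m, hm, ?_, hmc⟩
            rintro rfl
            exact hS ⟨hi, hmc⟩
        · exact mem_union_left _ (mem_filter.2 ⟨hSW, hi⟩)
      have h3 : (#{S ∈ tup s (nbr G' j f) | ¬ Injective S} : ℝ) ≤ s ^ 2 * Δ ^ (s - 1) := by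
        calc (#{S ∈ tup s (nbr G' j f) | ¬ Injective S} : ℝ)
            ≤ s ^ 2 * (#(nbr G' j f) : ℝ) ^ (s - 1) := by
              exact_mod_cast card_tup_not_injective_le hs _
          _ ≤ _ := mul_le_mul_of_nonneg_left
            (pow_le_pow_left₀ (Nat.cast_nonneg _) (hdegle f) _) (sq_nonneg _)
      have h4 : ∀ z ∈ nbr G₅ j f, (bad f z : ℝ) ≤ ∑ m ∈ univ.filter fun m => m ≠ j ∧ m ≠ k,
          (#{S ∈ tup s (C z (f k)) | f m ∈ c (univ.image S)} : ℝ) := by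
        intro z _
        have : bad f z ≤ ∑ m ∈ univ.filter fun m => m ≠ j ∧ m ≠ k,
            #{S ∈ tup s (C z (f k)) | f m ∈ c (univ.image S)} := by
          refine le_trans (card_le_card ?_) card_biUnion_le
          intro S hS
          obtain ⟨hSW, m, hmj, hmk, hmc⟩ := mem_filter.1 hS
          refine mem_biUnion.2 ⟨m, by simp [hmj, hmk], mem_filter.2 ⟨?_, hmc⟩⟩
          exact mem_tup.2 fun a => (mem_inter.1 (mem_tup.1 hSW a)).2
        exact_mod_cast this
      have h5 : (bad f (y₀ f) : ℝ) ≤ ∑ m ∈ univ.filter fun m => m ≠ j ∧ m ≠ k,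
          1 / d' * ∑ z with (#(C z (f k)) : ℝ) ≤ Δ,
            (#{S ∈ tup s (C z (f k)) | f m ∈ c (univ.image S)} : ℝ) := by
        rw [← mul_sum, sum_comm, one_div, inv_mul_eq_div, le_div_iff₀ hd'0, mul_comm]
        refine (hy₀ f hf).2.trans ((sum_le_sum h4).trans ?_)
        refine sum_le_sum_of_subset_of_nonneg ?_ fun _ _ _ =>
          sum_nonneg fun _ _ => Nat.cast_nonneg _
        intro z hz
        exact mem_filter.2 ⟨mem_univ _, (hcen' f z hz).1⟩
      have h2' : (#{S ∈ tup s (nbr G' j f) | ¬ Colored c S (f k)} : ℝ) ≤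
          #{S ∈ tup s (nbr G' j f) | ¬ Injective S} + bad f (y₀ f) := by exact_mod_cast h2
      linarith
    have h2 := sum_le_sum fun (f : Fin r → V) (_ : f ∈ univ) => h1 f
    rw [defect, Nat.cast_sum]
    refine h2.trans ?_
    rw [sum_add_distrib, sum_const, card_univ, Fintype.card_fun, Fintype.card_fin, nsmul_eq_mul,
      Nat.cast_pow, sum_comm]
    simp only [← mul_sum]
    have h3 : ∑ m ∈ univ.filter (fun m => m ≠ j ∧ m ≠ k), ∑ f : Fin r → V,
        ∑ z with (#(C z (f k)) : ℝ) ≤ Δ,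
          (#{S ∈ tup s (C z (f k)) | f m ∈ c (univ.image S)} : ℝ) ≤
        r * ((Fintype.card V : ℝ) ^ r * (T * Δ ^ s)) := by
      refine (sum_le_sum fun m hm =>
        sum_light_le hc (mem_filter.1 hm).2.2.symm C hΔ.le).trans ?_
      rw [sum_const, nsmul_eq_mul]
      have : #(univ.filter fun m : Fin r => m ≠ j ∧ m ≠ k) ≤ r :=
        (card_filter_le _ _).trans (by simp)
      gcongr
    calc _ ≤ (Fintype.card V : ℝ) ^ r * (s ^ 2 * Δ ^ (s - 1)) +
          1 / d' * (r * ((Fintype.card V : ℝ) ^ r * (T * Δ ^ s))) := by gcongr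
      _ = _ := by rw [hd']; field_simp; ring

/-! ### Counting along a chain of saturated positions. -/

theorem sum_close_pairs_ge (hs : 2 ≤ s) {G : Finset (Fin r → V)} {k l : Fin r} (hlk : l ≠ k)
    {a b : Fin s} (hab : a ≠ b) {d : ℝ} (hd : 0 < d) (hdeg : ∀ f ∈ G, d ≤ #(nbr G k f))
    (hdef : 4 * (defect s c G k l : ℝ) ≤ d ^ (s - 1) * (Fintype.card V * #G)) :
    d * (Fintype.card V * #G) / 8 ≤ Fintype.card V * ∑ h ∈ G,
      (#(nbr G k h ∩ close c a b (1 / 2 / 2 * d ^ (s - 2)) (h k) (h l)) : ℝ) := by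
  set C := close c a b (1 / 2 / 2 * d ^ (s - 2)) with hC
  have hp : ∀ f : Fin r → V, d * (#(nbr G k f) : ℝ) / 4 ≤
      (#{q ∈ nbr G k f ×ˢ nbr G k f | q.2 ∈ C q.1 (f l)} : ℝ) +
        (#{S ∈ tup s (nbr G k f) | ¬ Colored c S (f l)} : ℝ) / (2 * d ^ (s - 2)) := by
    intro f
    rcases (nbr G k f).eq_empty_or_nonempty with he | ⟨y, hy⟩
    · rw [he, card_empty, Nat.cast_zero, mul_zero, zero_div]
      positivity
    have hW := hdeg _ (mem_nbr.1 hy)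
    rw [nbr_update] at hW
    set W := nbr G k f
    have hW0 : (0 : ℝ) < #W := hd.trans_le hW
    have hle : d * (#W : ℝ) / 4 ≤ 1 / 2 / 2 * (#W : ℝ) ^ 2 := by nlinarith
    -- Either half of the tuples are coloured and close pairs abound, or the line contributes so
    -- much to the defect that the second term pays for it.
    by_cases hcol : 1 / 2 * (#W : ℝ) ^ s ≤ #{S ∈ tup s W | Colored c S (f l)}
    · have h1 := card_close_pairs_ge hs hab hd (by norm_num) hW hcol
      rw [← hC] at h1
      have h2 : (0 : ℝ) ≤ (#{S ∈ tup s W | ¬ Colored c S (f l)} : ℝ) / (2 * d ^ (s - 2)) := by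
        positivity
      linarith
    · push Not at hcol
      have h1 : (#{S ∈ tup s W | Colored c S (f l)} : ℝ) +
          #{S ∈ tup s W | ¬ Colored c S (f l)} = (#W : ℝ) ^ s := by
        have := card_filter_add_card_filter_not (s := tup s W) fun S => Colored c S (f l)
        rw [card_tup] at this
        exact_mod_cast this
      have h2 : 1 / 2 / 2 * (#W : ℝ) ^ 2 ≤
          (#{S ∈ tup s W | ¬ Colored c S (f l)} : ℝ) / (2 * d ^ (s - 2)) := by
        rw [le_div_iff₀ (by positivity)]
        calc 1 / 2 / 2 * (#W : ℝ) ^ 2 * (2 * d ^ (s - 2))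
            = 1 / 2 * ((#W : ℝ) ^ 2 * d ^ (s - 2)) := by ring
          _ ≤ 1 / 2 * ((#W : ℝ) ^ 2 * (#W : ℝ) ^ (s - 2)) := by gcongr
          _ = 1 / 2 * (#W : ℝ) ^ s := by rw [← pow_add]; congr 2; omega
          _ ≤ _ := by linarith
      have h3 : (0 : ℝ) ≤ #{q ∈ W ×ˢ W | q.2 ∈ C q.1 (f l)} := Nat.cast_nonneg _
      linarith
  have hsum := sum_le_sum fun (f : Fin r → V) (_ : f ∈ univ) => hp f
  rw [sum_add_distrib, ← sum_div, ← sum_div, ← mul_sum, sum_card_nbr] at hsum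
  have hdef' : ∑ f, (#{S ∈ tup s (nbr G k f) | ¬ Colored c S (f l)} : ℝ) = defect s c G k l := by
    rw [defect, Nat.cast_sum]
  have hdd : (defect s c G k l : ℝ) / (2 * d ^ (s - 2)) ≤ d * (Fintype.card V * #G) / 8 := by
    rw [div_le_iff₀ (by positivity)]
    have : d ^ (s - 1) = d * d ^ (s - 2) := by rw [← pow_succ']; congr 1; omega
    rw [this] at hdef
    linarith
  rw [hdef'] at hsum
  have hpairs : ∑ f : Fin r → V, (#{q ∈ nbr G k f ×ˢ nbr G k f | q.2 ∈ C q.1 (f l)} : ℝ) =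
      Fintype.card V * ∑ h ∈ G, (#(nbr G k h ∩ C (h k) (h l)) : ℝ) := by
    rw [← sum_sum_nbr G k]
    refine sum_congr rfl fun f _ => ?_
    simp only [nbr_update, update_self, update_of_ne hlk]
    rw [card_filter, sum_product, Nat.cast_sum]
    refine sum_congr rfl fun y _ => ?_
    rw [← card_filter]
    dsimp only
    rw [filter_mem_eq_inter]
  linarith

/-- The power counts `s`-tuples `S` in a common neighbourhood. Those coloured by `y` number at most
`T` for each `S`; the others are charged to the defect, with at most `Δ` choices for the remaining
vertex. -/
theorem sum_pow_common_nbr_le (hs : 2 ≤ s) (hc : ∀ S, #(c S) ≤ T) {G : Finset (Fin r → V)}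
    {j k : Fin r} (hkj : k ≠ j) {Δ : ℝ} (hΔj : ∀ f, (#(nbr G j f) : ℝ) ≤ Δ)
    (hΔk : ∀ f, (#(nbr G k f) : ℝ) ≤ Δ) :
    ∑ g : Fin r → V, ∑ y, (#(nbr G j g ∩ nbr G j (update g k y)) : ℝ) ^ s ≤
      T * Δ ^ (s - 1) * (Fintype.card V * #G) + defect s c G j k * Δ := by
  have hsplit : ∀ (g : Fin r → V) (y : V), (#(nbr G j g ∩ nbr G j (update g k y)) : ℝ) ^ s ≤
      #{S ∈ tup s (nbr G j g) | Colored c S y} +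
      #{S ∈ tup s (nbr G j g ∩ nbr G j (update g k y)) | ¬ Colored c S y} := by
    intro g y
    have h1 := card_filter_add_card_filter_not (s := tup s (nbr G j g ∩ nbr G j (update g k y)))
      fun S => Colored c S y
    rw [card_tup] at h1
    have h2 : #{S ∈ tup s (nbr G j g ∩ nbr G j (update g k y)) | Colored c S y} ≤
        #{S ∈ tup s (nbr G j g) | Colored c S y} := by
      refine card_le_card fun S hS => ?_
      obtain ⟨hSW, hS⟩ := mem_filter.1 hS
      exact mem_filter.2 ⟨mem_tup.2 fun a => (mem_inter.1 (mem_tup.1 hSW a)).1, hS⟩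
    have h3 : #(nbr G j g ∩ nbr G j (update g k y)) ^ s ≤
      #{S ∈ tup s (nbr G j g) | Colored c S y} +
      #{S ∈ tup s (nbr G j g ∩ nbr G j (update g k y)) | ¬ Colored c S y} := by omega
    exact_mod_cast h3
  have hcol : ∑ g : Fin r → V, ∑ y, (#{S ∈ tup s (nbr G j g) | Colored c S y} : ℝ) ≤
      T * Δ ^ (s - 1) * (Fintype.card V * #G) := by
    rw [← sum_card_nbr G j, mul_sum]
    refine sum_le_sum fun g _ => ?_
    have h1 : ∑ y, #{S ∈ tup s (nbr G j g) | Colored c S y} ≤ #(nbr G j g) ^ s * T := by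
      simp only [card_filter]
      rw [sum_comm]
      calc _ ≤ ∑ _S ∈ tup s (nbr G j g), T := by
            refine sum_le_sum fun S _ => ?_
            rw [← card_filter]
            exact (card_le_card fun w hw => (mem_filter.1 hw).2.2).trans (hc (univ.image S))
        _ = _ := by rw [sum_const, card_tup, smul_eq_mul]
    calc ∑ y, (#{S ∈ tup s (nbr G j g) | Colored c S y} : ℝ) ≤ (#(nbr G j g) : ℝ) ^ s * T := by
          exact_mod_cast h1
      _ = T * (#(nbr G j g) : ℝ) ^ (s - 1) * #(nbr G j g) := by
          rw [mul_assoc, ← pow_succ, Nat.sub_add_cancel (by omega), mul_comm]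
      _ ≤ T * Δ ^ (s - 1) * #(nbr G j g) := by
          have := hΔj g
          gcongr
  have hbad : ∑ g : Fin r → V, ∑ y,
      (#{S ∈ tup s (nbr G j g ∩ nbr G j (update g k y)) | ¬ Colored c S y} : ℝ) ≤
        defect s c G j k * Δ := by
    -- After exchanging `y` with the `k`-th entry, the missing colour is an entry of the tuple
    -- itself, as in `defect`.
    have h1 := sum_update_swap (V := V) k fun g y =>
      (#{S ∈ tup s (nbr G j (update g k y) ∩ nbr G j g) | ¬ Colored c S (g k)} : ℝ)
    simp only [update_idem, update_eq_self, update_self] at h1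
    rw [h1, defect, Nat.cast_sum, sum_mul]
    refine sum_le_sum fun g _ => ?_
    have h2 : ∑ y, (#{S ∈ tup s (nbr G j (update g k y) ∩ nbr G j g) | ¬ Colored c S (g k)} : ℝ) ≤
        ∑ S ∈ {S ∈ tup s (nbr G j g) | ¬ Colored c S (g k)},
          ∑ y, if S ∈ tup s (nbr G j (update g k y)) then (1 : ℝ) else 0 := by
      rw [sum_comm]
      refine sum_le_sum fun y _ => ?_
      rw [sum_boole]
      refine Nat.cast_le.2 (card_le_card fun S hS => ?_)
      obtain ⟨hSW, hS⟩ := mem_filter.1 hS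
      have := fun a => mem_inter.1 (mem_tup.1 hSW a)
      exact mem_filter.2 ⟨mem_filter.2 ⟨mem_tup.2 fun a => (this a).2, hS⟩,
        mem_tup.2 fun a => (this a).1⟩
    refine h2.trans ?_
    rw [← nsmul_eq_mul, ← sum_const]
    refine sum_le_sum fun S _ => ?_
    rw [sum_boole]
    -- One entry of `S` suffices: placed in position `j`, it confines `y` to a neighbourhood in
    -- position `k`.
    refine le_trans (Nat.cast_le.2 (card_le_card fun y hy => ?_))
      (hΔk (update g j (S ⟨0, by omega⟩)))
    have := mem_nbr.1 (mem_tup.1 (mem_filter.1 hy).2 ⟨0, by omega⟩)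
    rw [mem_nbr, update_comm hkj.symm]
    exact this
  calc _ ≤ ∑ g : Fin r → V, ∑ y, ((#{S ∈ tup s (nbr G j g) | Colored c S y} : ℝ) +
      #{S ∈ tup s (nbr G j g ∩ nbr G j (update g k y)) | ¬ Colored c S y}) :=
        sum_le_sum fun g _ => sum_le_sum fun y _ => hsplit g y
    _ ≤ _ := by
      simp only [sum_add_distrib]
      linarith

theorem card_close_filter_le [Nonempty V] (hs : 2 ≤ s) (hc : ∀ S, #(c S) ≤ T) {k l : Fin r}
    (hkl : k ≠ l) (a b : Fin s) {d : ℝ} (hd : 0 < d) :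
    (#{q : (Fin r → V) × V | q.2 ∈ close c a b (1 / 2 / 2 * d ^ (s - 2)) (q.1 k) (q.1 l)} : ℝ) ≤
      4 * T * (Fintype.card V : ℝ) ^ (r + s - 2) / d ^ (s - 2) := by
  have hN : (0 : ℝ) < Fintype.card V := by exact_mod_cast Fintype.card_pos
  have h6 := sum_card_close_le hc a b (1 / 2 / 2 * d ^ (s - 2))
  generalize hC : close c a b (1 / 2 / 2 * d ^ (s - 2)) = C at h6 ⊢
  set L : Finset ((Fin r → V) × V) := univ.filter fun q => q.2 ∈ C (q.1 k) (q.1 l) with hL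
  have h4 : (#L : ℝ) = ∑ g : Fin r → V, (#(C (g k) (g l)) : ℝ) := by
    rw [← Nat.cast_sum]
    congr 1
    rw [hL, card_filter, Fintype.sum_prod_type]
    refine sum_congr rfl fun g _ => ?_
    rw [← card_filter]
    dsimp only
    rw [filter_mem_eq_inter, univ_inter]
  have h5 := sum_pair (V := V) hkl fun x y => (#(C x y) : ℝ)
  rw [← h4] at h5
  rw [le_div_iff₀ (by positivity)]
  have h7 : (Fintype.card V : ℝ) ^ 2 * (#L * d ^ (s - 2)) ≤
      (Fintype.card V : ℝ) ^ 2 * (4 * T * (Fintype.card V : ℝ) ^ (r + s - 2)) := by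
    calc (Fintype.card V : ℝ) ^ 2 * (#L * d ^ (s - 2))
        = 4 * (Fintype.card V : ℝ) ^ r *
          (1 / 2 / 2 * d ^ (s - 2) * ∑ x, ∑ y, (#(C x y) : ℝ)) := by
          rw [← mul_assoc, h5]; ring
      _ ≤ 4 * (Fintype.card V : ℝ) ^ r * (T * (Fintype.card V : ℝ) ^ s) := by gcongr
      _ = _ := by
        have : (Fintype.card V : ℝ) ^ r * (Fintype.card V : ℝ) ^ s =
            (Fintype.card V : ℝ) ^ 2 * (Fintype.card V : ℝ) ^ (r + s - 2) := by
          rw [← pow_add, ← pow_add]; congr 1; omega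
        linear_combination 4 * T * this
  exact le_of_mul_le_mul_left h7 (by positivity)

/-- If position `j` is saturated by position `k`, and position `k` by a position `l ≠ j`, then
`G` is small. -/
theorem saturated_chain_bound [Nonempty V] (hs : 2 ≤ s) (hc : ∀ S, #(c S) ≤ T)
    {G : Finset (Fin r → V)} {j k l : Fin r} (hkj : k ≠ j) (hlk : l ≠ k) (hlj : l ≠ j) {d Δ : ℝ}
    (hd : 0 < d) (hdeg : ∀ f ∈ G, d ≤ #(nbr G k f)) (hΔj : ∀ f, (#(nbr G j f) : ℝ) ≤ Δ)
    (hΔk : ∀ f, (#(nbr G k f) : ℝ) ≤ Δ)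
    (hdef : 4 * (defect s c G k l : ℝ) ≤ d ^ (s - 1) * (Fintype.card V * #G)) :
    (d * (Fintype.card V * #G) / 8) ^ s ≤
      (4 * T * (Fintype.card V : ℝ) ^ (r + s - 2) / d ^ (s - 2)) ^ (s - 1) *
        (T * Δ ^ (s - 1) * (Fintype.card V * #G) + defect s c G j k * Δ) := by
  have hN : (0 : ℝ) < Fintype.card V := by exact_mod_cast Fintype.card_pos
  obtain ⟨a, b, hab⟩ : ∃ a b : Fin s, a ≠ b := ⟨⟨0, by omega⟩, ⟨1, by omega⟩, by simp⟩
  have h1 := sum_close_pairs_ge (c := c) hs hlk hab hd hdeg hdef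
  set C := close c a b (1 / 2 / 2 * d ^ (s - 2)) with hC
  let Λ : Finset ((Fin r → V) × V) := univ.filter fun q => q.2 ∈ C (q.1 k) (q.1 l)
  let w : (Fin r → V) × V → ℝ := fun q => #(nbr G j q.1 ∩ nbr G j (update q.1 k q.2))
  -- Since `k` and `l` differ from `j`, closeness ignores position `j`. For fixed `g` and `y`, the
  -- admissible `j`-th entries therefore form the common neighbourhood counted by `w`.
  have h2 : (Fintype.card V : ℝ) * ∑ h ∈ G, (#(nbr G k h ∩ C (h k) (h l)) : ℝ) = ∑ q ∈ Λ, w q := by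
    rw [← sum_sum_nbr G j, sum_filter, Fintype.sum_prod_type]
    refine sum_congr rfl fun g _ => ?_
    simp only [w, update_of_ne hkj, update_of_ne hlj]
    have h3 : ∀ z, nbr G k (update g j z) ∩ C (g k) (g l) =
        univ.filter fun y => y ∈ C (g k) (g l) ∧ z ∈ nbr G j (update g k y) := by
      intro z
      ext y
      simp only [mem_inter, mem_nbr, mem_filter, mem_univ, true_and, update_comm hkj]
      exact and_comm
    simp only [h3, card_filter, Nat.cast_sum]
    rw [sum_comm]
    refine sum_congr rfl fun y _ => ?_
    by_cases hy : y ∈ C (g k) (g l)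
    · simp [hy]
    · simp [hy]
  have h3 : (#Λ : ℝ) ≤ 4 * T * (Fintype.card V : ℝ) ^ (r + s - 2) / d ^ (s - 2) :=
    card_close_filter_le hs hc hlk.symm a b hd
  have h4 : (∑ q ∈ Λ, w q) ^ s ≤ (#Λ : ℝ) ^ (s - 1) * ∑ q ∈ Λ, w q ^ s := by
    have := pow_sum_le_card_mul_sum_pow (s := Λ) (f := w) (fun q _ => Nat.cast_nonneg _) (s - 1)
    rwa [Nat.sub_add_cancel (by omega)] at this
  have h5 : ∑ q ∈ Λ, w q ^ s ≤
      T * Δ ^ (s - 1) * (Fintype.card V * #G) + defect s c G j k * Δ := by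
    refine le_trans ?_ (sum_pow_common_nbr_le hs hc hkj hΔj hΔk)
    rw [← Fintype.sum_prod_type']
    exact sum_le_univ_sum_of_nonneg fun q => pow_nonneg (Nat.cast_nonneg _) _
  rw [h2] at h1
  refine (pow_le_pow_left₀ (by positivity) h1 s).trans (h4.trans ?_)
  exact mul_le_mul (pow_le_pow_left₀ (Nat.cast_nonneg _) h3 _) h5
    (sum_nonneg fun q _ => pow_nonneg (Nat.cast_nonneg _) _) (by positivity)

end

/-! ### Asymptotic form of the bootstrap. -/

theorem mul_rpow_pow {x : ℝ} (hx : 0 < x) (K a : ℝ) (m : ℕ) :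
    (K * x ^ a) ^ m = K ^ m * x ^ (a * m) := by
  rw [mul_pow, ← Real.rpow_mul_natCast hx.le]

theorem eventually_mul_rpow_lt {A B : ℝ} (h : B < A) (K : ℝ) :
    ∀ᶠ n : ℕ in atTop, K * (n : ℝ) ^ B < (n : ℝ) ^ A := by
  have h1 : Tendsto (fun n : ℕ => (n : ℝ) ^ (A - B)) atTop atTop :=
    (tendsto_rpow_atTop (sub_pos.2 h)).comp tendsto_natCast_atTop_atTop
  filter_upwards [h1.eventually_gt_atTop K, eventually_ge_atTop 1] with n hn hn1
  have hx : (0 : ℝ) < n := by exact_mod_cast hn1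
  have : (n : ℝ) ^ A = (n : ℝ) ^ (A - B) * (n : ℝ) ^ B := by
    rw [← Real.rpow_add hx]; congr 1; ring
  rw [this]
  have := Real.rpow_pos_of_pos hx B
  gcongr

/-- Dense covered sets of tuples have at least about `n ^ (2 - η)` pairs in any two positions. -/
def PairsBound (r s T : ℕ) (δ η : ℝ) : Prop :=
  ∀ c : ℝ, 0 < c → ∃ c' : ℝ, 0 < c' ∧ ∀ᶠ n : ℕ in atTop,
    ∀ cov : Finset (Fin n) → Finset (Fin n), (∀ S, #(cov S) ≤ T) →
      ∀ G : Finset (Fin r → Fin n), Covered s cov G → c * (n : ℝ) ^ ((r : ℝ) - δ) ≤ #G →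
        ∀ a b, a ≠ b → c' * (n : ℝ) ^ (2 - η) ≤ #(pairs G a b)

/-- A pair of entries extends to only `n ^ (r - 2)` tuples. -/
theorem pairsBound_self (r s T : ℕ) (δ : ℝ) : PairsBound r s T δ δ := by
  intro c hc
  refine ⟨c, hc, ?_⟩
  filter_upwards [eventually_ge_atTop 1] with n hn cov hcov G hG hcard a b hab
  have hx : (0 : ℝ) < n := by exact_mod_cast hn
  have h1 := card_filter_pair hab (pairs G a b)
  rw [Fintype.card_fin] at h1
  have h2 : #G ≤ #{f : Fin r → Fin n | (f a, f b) ∈ pairs G a b} :=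
    card_le_card fun f hf => mem_filter.2 ⟨mem_univ _, mem_image_of_mem _ hf⟩
  have h2' : (#G : ℝ) ≤ #{f : Fin r → Fin n | (f a, f b) ∈ pairs G a b} := by exact_mod_cast h2
  have h3 : (n : ℝ) ^ r * (c * (n : ℝ) ^ (2 - δ)) ≤ (n : ℝ) ^ r * #(pairs G a b) := by
    calc (n : ℝ) ^ r * (c * (n : ℝ) ^ (2 - δ))
        = (n : ℝ) ^ 2 * (c * (n : ℝ) ^ ((r : ℝ) - δ)) := by
          rw [← Real.rpow_natCast _ r, ← Real.rpow_natCast _ 2, mul_left_comm, ← Real.rpow_add hx,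
            mul_left_comm, ← Real.rpow_add hx]
          congr 2
          push_cast
          ring
      _ ≤ (n : ℝ) ^ 2 * #{f : Fin r → Fin n | (f a, f b) ∈ pairs G a b} := by
          gcongr
          exact hcard.trans h2'
      _ = _ := h1
  exact le_of_mul_le_mul_left h3 (by positivity)

/-- If `a`, `b` violated the bound, degrees of order `n ^ (1 - δ + η)` would be available in a third
position, leaving at most about `n ^ (s - (s - 1) * (1 - δ + η))` pairs elsewhere. By the relation
between `η` and `η'` this exponent is `2 - η'`, so only constants decide. -/
theorem PairsBound.step {r s T : ℕ} {δ η η' : ℝ} (h : PairsBound r s T δ η') (hr : 3 ≤ r)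
    (hs : 2 ≤ s) (hT : 1 ≤ T) (hδ : δ < 1) (hη : 0 ≤ η)
    (hηη : ((s : ℝ) - 1) * η = η' + ((s : ℝ) - 1) * δ - 1) : PairsBound r s T δ η := by
  intro c hc
  have hr0 : (0 : ℝ) < r := by exact_mod_cast (by omega : 0 < r)
  have hT0 : (0 : ℝ) < T := by exact_mod_cast hT
  obtain ⟨c'', hc'', hev⟩ := h (c / (8 * r ^ 2)) (by positivity)
  -- Twice the value at which the two constants would balance, to force strictness; `κ ≥ 1` gives `κ
  -- ≤ κ ^ (s - 1)`.
  obtain ⟨κ, hκ1, hκ2⟩ : ∃ κ : ℝ, 1 ≤ κ ∧ 8 * r * T / c'' ≤ κ :=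
    ⟨max 1 (8 * r * T / c''), le_max_left _ _, le_max_right _ _⟩
  have hκ0 : 0 < κ := by linarith
  refine ⟨c / (2 * κ), by positivity, ?_⟩
  filter_upwards [eventually_ge_atTop 1, hev,
    eventually_mul_rpow_lt (sub_pos.2 hδ) (2 * (s : ℝ) ^ 2)] with n hn hev hlarge cov hcov G hG
    hcard a b hab
  have hx : (0 : ℝ) < n := by exact_mod_cast hn
  have hx1 : (1 : ℝ) ≤ n := by exact_mod_cast hn
  by_contra! hcon
  obtain ⟨l, hl⟩ : ∃ l : Fin r, l ∉ ({a, b} : Finset (Fin r)) := by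
    by_contra! hall
    have h1 := card_le_card (fun l _ => hall l : (univ : Finset (Fin r)) ⊆ {a, b})
    have h2 := card_le_two (a := a) (b := b)
    rw [card_univ, Fintype.card_fin] at h1
    omega
  simp only [mem_insert, mem_singleton, not_or] at hl
  have : Nonempty (Fin n) := ⟨⟨0, hn⟩⟩
  have hGpos : (0 : ℝ) < #G := lt_of_lt_of_le (by positivity) hcard
  have hne : G.Nonempty := card_pos.1 (by exact_mod_cast hGpos)
  rw [Real.rpow_zero, mul_one] at hlarge
  have hdge : (n : ℝ) ^ (1 - δ) ≤ κ * (n : ℝ) ^ (1 - δ + η) := by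
    calc (n : ℝ) ^ (1 - δ) ≤ (n : ℝ) ^ (1 - δ + η) :=
          Real.rpow_le_rpow_of_exponent_le hx1 (by linarith)
      _ ≤ _ := le_mul_of_one_le_left (by positivity) hκ1
  obtain ⟨m, hm, G', hG', hcard', hpairs⟩ := exists_few_pairs hs hcov hne hG hab hl.1 hl.2
    (d := κ * (n : ℝ) ^ (1 - δ + η)) (hlarge.le.trans hdge) (by
      rw [Fintype.card_fin]
      calc 2 * (κ * (n : ℝ) ^ (1 - δ + η) * ((n : ℝ) ^ r * #(pairs G a b)))
          ≤ 2 * (κ * (n : ℝ) ^ (1 - δ + η) * ((n : ℝ) ^ r * (c / (2 * κ) * (n : ℝ) ^ (2 - η)))) := by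
            gcongr
        _ = c * ((n : ℝ) ^ (1 - δ + η) * (n : ℝ) ^ r * (n : ℝ) ^ (2 - η)) := by
            field_simp
        _ = (n : ℝ) ^ 3 * (c * (n : ℝ) ^ ((r : ℝ) - δ)) := by
            rw [mul_left_comm ((n : ℝ) ^ 3), ← Real.rpow_natCast _ r, ← Real.rpow_natCast _ 3]
            simp only [← Real.rpow_add hx]
            congr 2
            push_cast
            ring
        _ ≤ _ := by gcongr)
  have hcard'' : c / (8 * r ^ 2) * (n : ℝ) ^ ((r : ℝ) - δ) ≤ #G' := by
    rw [div_mul_eq_mul_div, div_le_iff₀ (by positivity)]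
    linarith
  have h1 := hev cov hcov G' (hG.mono hG') hcard'' l m hm.symm
  rw [Fintype.card_fin, mul_rpow_pow hx] at hpairs
  have hcast : ((s - 1 : ℕ) : ℝ) = (s : ℝ) - 1 := by
    rw [Nat.cast_sub (by omega)]; simp
  have h2 : κ ^ (s - 1) * c'' * (n : ℝ) ^ s ≤ 4 * r * T * (n : ℝ) ^ s := by
    calc κ ^ (s - 1) * c'' * (n : ℝ) ^ s
        = κ ^ (s - 1) * (n : ℝ) ^ ((1 - δ + η) * (s - 1 : ℕ)) * (c'' * (n : ℝ) ^ (2 - η')) := by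
          rw [mul_mul_mul_comm, ← Real.rpow_add hx, ← Real.rpow_natCast _ s]
          congr 2
          rw [hcast]
          linear_combination -hηη
      _ ≤ κ ^ (s - 1) * (n : ℝ) ^ ((1 - δ + η) * (s - 1 : ℕ)) * #(pairs G' l m) := by gcongr
      _ ≤ 4 * r * (T * (n : ℝ) ^ s) := hpairs
      _ = _ := by ring
  have h3 := le_of_mul_le_mul_right h2 (by positivity)
  have h4 : κ ≤ κ ^ (s - 1) := le_self_pow₀ hκ1 (by omega)
  have h5 : 8 * r * T ≤ κ * c'' := by rwa [div_le_iff₀ hc''] at hκ2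
  have h6 : κ * c'' ≤ κ ^ (s - 1) * c'' := by gcongr
  have h7 : (0 : ℝ) < r * T := by positivity
  nlinarith

/-! ### Asymptotic saturation of all positions. -/

/-- The conclusion of saturation in position `j`, with constant `C` and `ω` the exponent of the
degree bound. -/
def Saturated {r n : ℕ} (s : ℕ) (cov : Finset (Fin n) → Finset (Fin n)) (δ ω C : ℝ)
    (G : Finset (Fin r → Fin n)) (j k : Fin r) : Prop :=
  k ≠ j ∧ (∀ f, (#(nbr G j f) : ℝ) ≤ C * (n : ℝ) ^ ω) ∧
    (defect s cov G j k : ℝ) ≤ C * (n : ℝ) ^ (r + s * ω - (1 - δ))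

theorem Saturated.mono {r n s : ℕ} {cov : Finset (Fin n) → Finset (Fin n)} {δ ω C C' : ℝ}
    {G H : Finset (Fin r → Fin n)} {j k : Fin r} (h : Saturated s cov δ ω C H j k) (hGH : G ⊆ H)
    (hC : C ≤ C') : Saturated s cov δ ω C' G j k := by
  refine ⟨h.1, fun f => ?_, ?_⟩
  · calc (#(nbr G j f) : ℝ) ≤ #(nbr H j f) := by exact_mod_cast card_le_card (nbr_mono hGH j f)
      _ ≤ C * (n : ℝ) ^ ω := h.2.1 f
      _ ≤ _ := by gcongr
  · calc (defect s cov G j k : ℝ) ≤ defect s cov H j k := by exact_mod_cast defect_mono hGH j k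
      _ ≤ C * (n : ℝ) ^ (r + s * ω - (1 - δ)) := h.2.2
      _ ≤ _ := by gcongr

theorem PairsBound.exists_saturated {r s T : ℕ} {δ η ω : ℝ} (h : PairsBound r s T δ η)
    (hs : 2 ≤ s) (hT : 1 ≤ T) (hδ : δ < 1) (hω : ω = ((s : ℝ) - 2) * δ + η) (hωδ : 1 - δ ≤ ω)
    (j : Fin r) (c : ℝ) (hc : 0 < c) :
    ∃ c' : ℝ, 0 < c' ∧ ∃ C : ℝ, ∀ᶠ n : ℕ in atTop,
      ∀ cov : Finset (Fin n) → Finset (Fin n), (∀ S, #(cov S) ≤ T) →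
        ∀ G : Finset (Fin r → Fin n), Covered s cov G → c * (n : ℝ) ^ ((r : ℝ) - δ) ≤ #G →
          ∃ k, ∃ G' ⊆ G, c' * (n : ℝ) ^ ((r : ℝ) - δ) ≤ #G' ∧ Saturated s cov δ ω C G' j k := by
  have hr0 : (0 : ℝ) < r := by exact_mod_cast j.pos
  have hT0 : (0 : ℝ) < T := by exact_mod_cast hT
  obtain ⟨c'', hc'', hev⟩ := h (c / (32 * r ^ 2)) (by positivity)
  -- Chosen so that the condition relating `Δ` and `M` holds with equality; the powers of `n` match
  -- by the definition of `ω`.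
  set C₁ : ℝ := 4 * r * T / (c'' / 2 * (c / 2) ^ (s - 2)) with hC₁
  have hC₁0 : 0 < C₁ := by positivity
  refine ⟨c / (512 * r ^ 3), by positivity,
    C₁ + (32 * r ^ 3 * T * C₁ ^ s / (c / 2) + s ^ 2 * C₁ ^ (s - 1)), ?_⟩
  filter_upwards [eventually_ge_atTop 1, hev,
    eventually_mul_rpow_lt (sub_pos.2 hδ) (2 * (s : ℝ) ^ 2 / (c / 2))] with n hn hev hlarge cov hcov
    G hG hcard
  have hx : (0 : ℝ) < n := by exact_mod_cast hn
  have hx1 : (1 : ℝ) ≤ n := by exact_mod_cast hn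
  have : Nonempty (Fin n) := ⟨⟨0, hn⟩⟩
  have hGpos : (0 : ℝ) < #G := lt_of_lt_of_le (by positivity) hcard
  have hne : G.Nonempty := card_pos.1 (by exact_mod_cast hGpos)
  rw [Real.rpow_zero, mul_one, div_lt_iff₀ (by positivity),
    mul_comm ((n : ℝ) ^ (1 - δ))] at hlarge
  have hcast1 : ((s - 1 : ℕ) : ℝ) = (s : ℝ) - 1 := by
    rw [Nat.cast_sub (by omega)]; simp
  have hcast2 : ((s - 2 : ℕ) : ℝ) = (s : ℝ) - 2 := by
    rw [Nat.cast_sub (by omega)]; simp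
  obtain ⟨k, hk, G', hG', hcard', hdeg, hdef⟩ := TupleHypergraph.exists_saturated hs hcov hne hG
    (j := j) (d := c / 2 * (n : ℝ) ^ (1 - δ)) (Δ := C₁ * (n : ℝ) ^ ω)
    (M := c'' / 2 * (n : ℝ) ^ (2 - η)) hlarge.le (by
      rw [Fintype.card_fin]
      calc 2 * (c / 2 * (n : ℝ) ^ (1 - δ) * (n : ℝ) ^ r)
          = n * (c * (n : ℝ) ^ ((r : ℝ) - δ)) := by
            have : (n : ℝ) ^ (1 - δ) * (n : ℝ) ^ r = n * (n : ℝ) ^ ((r : ℝ) - δ) := by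
              rw [← Real.rpow_natCast _ r, ← Real.rpow_add hx, ← Real.rpow_one_add' hx.le]
              · congr 1; ring
              · have : (1 : ℝ) ≤ r := by exact_mod_cast j.pos
                linarith
            linear_combination c * this
        _ ≤ _ := by gcongr)
    (by positivity) (by
      rw [Fintype.card_fin, mul_rpow_pow hx, hcast2]
      refine le_of_eq ?_
      have : (n : ℝ) ^ s =
          (n : ℝ) ^ ω * (n : ℝ) ^ (2 - η) * (n : ℝ) ^ ((1 - δ) * ((s : ℝ) - 2)) := by
        rw [← Real.rpow_natCast, ← Real.rpow_add hx, ← Real.rpow_add hx]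
        congr 1
        rw [hω]; ring
      rw [this, hC₁]
      field_simp)
    (by
      intro k hk G' hG' hcard'
      have h1 := hev cov hcov G' (hG.mono hG') (by
        rw [div_mul_eq_mul_div, div_le_iff₀ (by positivity)]
        linarith) j k hk.symm
      refine lt_of_lt_of_le ?_ h1
      have : 0 < (n : ℝ) ^ (2 - η) := by positivity
      nlinarith)
  refine ⟨k, G', hG', ?_, hk, fun f => (hdeg f).trans ?_, hdef.trans ?_⟩
  · rw [div_mul_eq_mul_div, div_le_iff₀ (by positivity)]
    linarith
  · have : 0 ≤ 32 * r ^ 3 * T * C₁ ^ s / (c / 2) + s ^ 2 * C₁ ^ (s - 1) := by positivity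
    gcongr
    linarith
  · rw [Fintype.card_fin, mul_rpow_pow hx, mul_rpow_pow hx, hcast1]
    have h1 : (n : ℝ) ^ r * (32 * r ^ 3 * T * (C₁ ^ s * (n : ℝ) ^ (ω * s)) /
        (c / 2 * (n : ℝ) ^ (1 - δ))) =
        32 * r ^ 3 * T * C₁ ^ s / (c / 2) * (n : ℝ) ^ (r + s * ω - (1 - δ)) := by
      rw [Real.rpow_sub hx (r + s * ω) (1 - δ), Real.rpow_add hx (r : ℝ), Real.rpow_natCast,
        mul_comm (s : ℝ) ω]
      field_simp
    -- The non-injective tuples are absorbed because `1 - δ ≤ ω`.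
    have h2 : (n : ℝ) ^ r * (n : ℝ) ^ (ω * (s - 1)) ≤ (n : ℝ) ^ (r + s * ω - (1 - δ)) := by
      rw [← Real.rpow_natCast _ r, ← Real.rpow_add hx]
      exact Real.rpow_le_rpow_of_exponent_le hx1 (by linarith)
    have h3 : (n : ℝ) ^ r * (s ^ 2 * (C₁ ^ (s - 1) * (n : ℝ) ^ (ω * (s - 1)))) ≤
        s ^ 2 * C₁ ^ (s - 1) * (n : ℝ) ^ (r + s * ω - (1 - δ)) := by
      calc _ = s ^ 2 * C₁ ^ (s - 1) * ((n : ℝ) ^ r * (n : ℝ) ^ (ω * (s - 1))) := by ring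
        _ ≤ _ := by gcongr
    rw [mul_add, h1]
    have h4 : 0 ≤ C₁ * (n : ℝ) ^ (r + s * ω - (1 - δ)) := by positivity
    calc _ ≤ 32 * r ^ 3 * T * C₁ ^ s / (c / 2) * (n : ℝ) ^ (r + s * ω - (1 - δ)) +
          s ^ 2 * C₁ ^ (s - 1) * (n : ℝ) ^ (r + s * ω - (1 - δ)) := by gcongr
      _ ≤ _ := by rw [add_mul, add_mul]; linarith

/-- Saturation passes to subsets, so positions can be treated one at a time, with only constant
losses in density. -/
theorem PairsBound.exists_saturated_forall {r s T : ℕ} {δ η ω : ℝ} (h : PairsBound r s T δ η)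
    (hs : 2 ≤ s) (hT : 1 ≤ T) (hδ : δ < 1) (hω : ω = ((s : ℝ) - 2) * δ + η) (hωδ : 1 - δ ≤ ω)
    (J : Finset (Fin r)) (c : ℝ) (hc : 0 < c) :
    ∃ c' : ℝ, 0 < c' ∧ ∃ C : ℝ, ∀ᶠ n : ℕ in atTop,
      ∀ cov : Finset (Fin n) → Finset (Fin n), (∀ S, #(cov S) ≤ T) →
        ∀ G : Finset (Fin r → Fin n), Covered s cov G → c * (n : ℝ) ^ ((r : ℝ) - δ) ≤ #G →
          ∃ p : Fin r → Fin r, ∃ G' ⊆ G, c' * (n : ℝ) ^ ((r : ℝ) - δ) ≤ #G' ∧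
            ∀ j ∈ J, Saturated s cov δ ω C G' j (p j) := by
  induction J using Finset.induction_on with
  | empty =>
    exact ⟨c, hc, 0, Eventually.of_forall fun n cov hcov G hG hcard =>
      ⟨id, G, Subset.rfl, hcard, by simp⟩⟩
  | insert j J hj ih =>
    obtain ⟨c₁, hc₁, C₁, hev₁⟩ := ih
    obtain ⟨c₂, hc₂, C₂, hev₂⟩ := h.exists_saturated hs hT hδ hω hωδ j c₁ hc₁
    refine ⟨c₂, hc₂, max C₁ C₂, ?_⟩
    filter_upwards [hev₁, hev₂] with n hev₁ hev₂ cov hcov G hG hcard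
    obtain ⟨p, G₁, hG₁, hcard₁, hp⟩ := hev₁ cov hcov G hG hcard
    obtain ⟨k, G₂, hG₂, hcard₂, hk⟩ := hev₂ cov hcov G₁ (hG.mono hG₁) hcard₁
    refine ⟨update p j k, G₂, hG₂.trans hG₁, hcard₂, fun i hi => ?_⟩
    rcases eq_or_ne i j with rfl | hij
    · rw [update_self]
      exact hk.mono Subset.rfl (le_max_right _ _)
    · rw [update_of_ne hij]
      exact (hp i ((mem_insert.1 hi).resolve_left hij)).mono hG₂ (le_max_left _ _)

/-! ### Parity and the final contradiction. -/

/-- An involution of a set of odd size has a fixed point. This is where the parity of `r` enters. -/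
theorem exists_apply_apply_ne {r : ℕ} (hr : Odd r) (p : Fin r → Fin r) (hp : ∀ j, p j ≠ j) :
    ∃ j, p (p j) ≠ j := by
  by_contra! h
  have hinv : Involutive p := h
  obtain ⟨j, hj⟩ := Equiv.Perm.exists_fixed_point_of_prime (p := 2) (n := 1) (σ := hinv.toPerm)
    (by rw [Fintype.card_fin]; exact hr.not_two_dvd_nat) (by ext j; simp [sq, h])
  exact hp j hj

/-- The numerical contradiction between the bounds on a saturated chain. -/
theorem chain_bound_numeric {s : ℕ} (hs : 2 ≤ s) {x r T κ C δ ω d g Δ E : ℝ} (hx : 0 < x)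
    (hT : 0 < T) (hκ : 0 < κ) (hC : 0 < C) (hd : d = κ * x ^ (1 - δ))
    (hg : κ * x ^ (r + (1 - δ)) ≤ g)
    (hΔ : Δ = C * x ^ ω) (hE : E ≤ C * x ^ (r + s * ω - (1 - δ)))
    (h : (d * g / 8) ^ s ≤ (4 * T * x ^ (r + (s - 2)) / d ^ (s - 2)) ^ (s - 1) *
      (T * Δ ^ (s - 1) * g + E * Δ)) :
    (κ / 8) ^ s * κ ^ (s - 1) * x ^ ((1 - δ) * s + (r + (1 - δ)) * (s - 1)) ≤
      (4 * T / κ ^ (s - 2)) ^ (s - 1) * (T * C ^ (s - 1)) *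
        x ^ ((r + (s - 2) * δ) * (s - 1) + ω * (s - 1)) +
      (4 * T / κ ^ (s - 2)) ^ (s - 1) * (C ^ 2 / κ) *
        x ^ ((r + (s - 2) * δ) * (s - 1) + ((s + 1) * ω - 2 * (1 - δ))) := by
  have hcast1 : ((s - 1 : ℕ) : ℝ) = (s : ℝ) - 1 := by
    rw [Nat.cast_sub (by omega)]; simp
  have hcast2 : ((s - 2 : ℕ) : ℝ) = (s : ℝ) - 2 := by
    rw [Nat.cast_sub (by omega)]; simp
  have hg0 : 0 < g := lt_of_lt_of_le (by positivity) hg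
  have hd0 : 0 < d := by rw [hd]; positivity
  have hΔ0 : 0 < Δ := by rw [hΔ]; positivity
  set R : ℝ := T * C ^ (s - 1) * x ^ (ω * (s - 1)) +
    C ^ 2 / κ * x ^ ((s + 1) * ω - 2 * (1 - δ)) with hR
  have h1 : T * Δ ^ (s - 1) * g + E * Δ ≤ g * R := by
    have h2 : T * Δ ^ (s - 1) * g = g * (T * C ^ (s - 1) * x ^ (ω * (s - 1))) := by
      rw [hΔ, mul_rpow_pow hx, hcast1]; ring
    have h3 : E * Δ ≤ g * (C ^ 2 / κ * x ^ ((s + 1) * ω - 2 * (1 - δ))) := by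
      calc E * Δ ≤ C * x ^ (r + s * ω - (1 - δ)) * (C * x ^ ω) := by rw [← hΔ]; gcongr
        _ = κ * x ^ (r + (1 - δ)) * (C ^ 2 / κ * x ^ ((s + 1) * ω - 2 * (1 - δ))) := by
          have : x ^ (r + s * ω - (1 - δ)) * x ^ ω =
              x ^ (r + (1 - δ)) * x ^ ((s + 1) * ω - 2 * (1 - δ)) := by
            rw [← Real.rpow_add hx, ← Real.rpow_add hx]; congr 1; ring
          have hk : κ * (C ^ 2 / κ) = C ^ 2 := by field_simp
          linear_combination C ^ 2 * this -
            x ^ (r + (1 - δ)) * x ^ ((s + 1) * ω - 2 * (1 - δ)) * hk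
        _ ≤ _ := by gcongr
    rw [hR, mul_add]
    linarith
  have hL : 4 * T * x ^ (r + (s - 2)) / d ^ (s - 2) =
      4 * T / κ ^ (s - 2) * x ^ (r + (s - 2) * δ) := by
    rw [hd, mul_rpow_pow hx, hcast2]
    have : x ^ (r + ((s : ℝ) - 2)) = x ^ (r + (s - 2) * δ) * x ^ ((1 - δ) * ((s : ℝ) - 2)) := by
      rw [← Real.rpow_add hx]; congr 1; ring
    rw [this]
    field_simp
  have h2 : (d / 8) ^ s * g ^ (s - 1) ≤ (4 * T * x ^ (r + (s - 2)) / d ^ (s - 2)) ^ (s - 1) * R := by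
    have h3 : (d / 8) ^ s * g ^ (s - 1) * g ≤
        (4 * T * x ^ (r + (s - 2)) / d ^ (s - 2)) ^ (s - 1) * R * g := by
      calc (d / 8) ^ s * g ^ (s - 1) * g = (d * g / 8) ^ s := by
            rw [mul_assoc, ← pow_succ, Nat.sub_add_cancel (by omega), ← mul_pow]; congr 1; ring
        _ ≤ _ := h
        _ ≤ (4 * T * x ^ (r + (s - 2)) / d ^ (s - 2)) ^ (s - 1) * (g * R) := by gcongr
        _ = _ := by ring
    exact le_of_mul_le_mul_right h3 hg0
  have h3 : (κ / 8) ^ s * κ ^ (s - 1) * x ^ ((1 - δ) * s + (r + (1 - δ)) * (s - 1)) ≤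
      (d / 8) ^ s * g ^ (s - 1) := by
    calc _ = (κ / 8 * x ^ (1 - δ)) ^ s * (κ * x ^ (r + (1 - δ))) ^ (s - 1) := by
          rw [mul_rpow_pow hx, mul_rpow_pow hx, hcast1, Real.rpow_add hx]; ring
      _ ≤ (κ / 8 * x ^ (1 - δ)) ^ s * g ^ (s - 1) := by gcongr
      _ = _ := by rw [hd]; congr 2; ring
  refine h3.trans (h2.trans (le_of_eq ?_))
  rw [hL, mul_rpow_pow hx, hcast1, hR, Real.rpow_add hx ((r + (s - 2) * δ) * (s - 1)) (ω * (s - 1)),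
    Real.rpow_add hx ((r + (s - 2) * δ) * (s - 1)) ((s + 1) * ω - 2 * (1 - δ))]
  ring

theorem PairsBound.card_lt {r s T : ℕ} {δ η ω : ℝ} (h : PairsBound r s T δ η) (hr : Odd r)
    (hs : 3 ≤ s) (hT : 1 ≤ T) (hδ : δ < 1) (hδs : 1 ≤ ((s : ℝ) - 1) * δ) (hη : 0 ≤ η)
    (hω : ω = ((s : ℝ) - 2) * δ + η)
    (hkey : ((s : ℝ) - 1) * ((s - 2) * δ) + (s + 1) * ω < (2 * s + 1) * (1 - δ)) :
    ∀ᶠ n : ℕ in atTop, ∀ cov : Finset (Fin n) → Finset (Fin n), (∀ S, #(cov S) ≤ T) →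
      ∀ G : Finset (Fin r → Fin n), Covered s cov G → (#G : ℝ) < (n : ℝ) ^ ((r : ℝ) - δ) := by
  have hs' : (3 : ℝ) ≤ s := by exact_mod_cast hs
  have hT0 : (0 : ℝ) < T := by exact_mod_cast hT
  have hωδ : 1 - δ ≤ ω := by rw [hω]; linarith
  obtain ⟨c', hc', C₀, hev⟩ := h.exists_saturated_forall (by omega) hT hδ hω hωδ univ 1 one_pos
  set κ : ℝ := c' / 2 with hκ
  have hκ0 : 0 < κ := by positivity
  set C : ℝ := max C₀ 1
  have hC0 : 0 < C := lt_of_lt_of_le one_pos (le_max_right _ _)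
  -- From `1 ≤ (s - 1) * δ` one gets `1 - δ ≤ (s - 2) * δ`. Together with `1 - δ ≤ ω`, this reduces
  -- the other exponent comparisons to `hkey`, which is the one for the defect term.
  have hexp2 : ((s : ℝ) - 1) * (1 - δ) ≤ ((s : ℝ) - 1) * ((s - 2) * δ) :=
    mul_le_mul_of_nonneg_left (by linarith) (by linarith)
  set K₁ : ℝ := (κ / 8) ^ s * κ ^ (s - 1)
  set K₂ : ℝ := (4 * T / κ ^ (s - 2)) ^ (s - 1) * (T * C ^ (s - 1))
  set K₃ : ℝ := (4 * T / κ ^ (s - 2)) ^ (s - 1) * (C ^ 2 / κ)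
  have hK₁ : 0 < K₁ := by positivity
  filter_upwards [hev, eventually_ge_atTop 1,
    eventually_mul_rpow_lt (A := (s : ℝ) * (1 - δ)) (B := s * ω - (1 - δ)) (by linarith)
      (4 * C / κ ^ s),
    eventually_mul_rpow_lt (A := (1 - δ) * s + (r + (1 - δ)) * (s - 1))
      (B := (r + (s - 2) * δ) * (s - 1) + ω * (s - 1)) (by linarith) (2 * K₂ / K₁),
    eventually_mul_rpow_lt (A := (1 - δ) * s + (r + (1 - δ)) * (s - 1))
      (B := (r + (s - 2) * δ) * (s - 1) + ((s + 1) * ω - 2 * (1 - δ))) (by linarith) (2 * K₃ / K₁)]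
    with n hev hn hlarge₁ hlarge₂ hlarge₃ cov hcov G hG
  have hx : (0 : ℝ) < n := by exact_mod_cast hn
  have : Nonempty (Fin n) := ⟨⟨0, hn⟩⟩
  by_contra! hcard
  obtain ⟨p, G₁, hG₁, hcard₁, hp⟩ := hev cov hcov G hG (by rwa [one_mul])
  have hp : ∀ j, Saturated s cov δ ω C G₁ j (p j) := fun j =>
    (hp j (mem_univ j)).mono Subset.rfl (le_max_left _ _)
  obtain ⟨j, hj⟩ := exists_apply_apply_ne hr p fun j => (hp j).1
  have hpow : (n : ℝ) * (n : ℝ) ^ ((r : ℝ) - δ) = (n : ℝ) ^ ((r : ℝ) + (1 - δ)) := by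
    nth_rewrite 1 [← Real.rpow_one (n : ℝ)]
    rw [← Real.rpow_add hx]
    congr 1
    ring
  obtain ⟨G₂, hG₂, hcard₂, hdeg⟩ := exists_minDegree (G := G₁) (F := univ) (i := p j)
    (d := κ * (n : ℝ) ^ (1 - δ)) (by positivity) (fun _ _ _ => mem_univ _) (by
      rw [card_univ, Fintype.card_fun, Fintype.card_fin, Fintype.card_fin, Nat.cast_pow]
      calc 2 * (κ * (n : ℝ) ^ (1 - δ) * (n : ℝ) ^ r) = c' * (n : ℝ) ^ ((r : ℝ) + (1 - δ)) := by
            rw [Real.rpow_add hx, Real.rpow_natCast, hκ]; ring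
        _ = n * (c' * (n : ℝ) ^ ((r : ℝ) - δ)) := by rw [← hpow]; ring
        _ ≤ _ := by gcongr)
  have hjk := (hp j).mono hG₂ le_rfl
  have hkl := (hp (p j)).mono hG₂ le_rfl
  have hg : κ * (n : ℝ) ^ ((r : ℝ) + (1 - δ)) ≤ n * #G₂ := by
    rw [← hpow, mul_left_comm]
    have : κ * (n : ℝ) ^ ((r : ℝ) - δ) ≤ #G₂ := by rw [hκ]; linarith
    gcongr
  have hbound := saturated_chain_bound (show 2 ≤ s by omega) hcov hjk.1 hkl.1 hj
    (d := κ * (n : ℝ) ^ (1 - δ)) (by positivity) hdeg hjk.2.1 hkl.2.1 (by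
      rw [Fintype.card_fin]
      have hcast1 : ((s - 1 : ℕ) : ℝ) = (s : ℝ) - 1 := by
        rw [Nat.cast_sub (by omega)]; simp
      rw [div_mul_eq_mul_div, div_lt_iff₀ (by positivity)] at hlarge₁
      calc 4 * (defect s cov G₂ (p j) (p (p j)) : ℝ)
          ≤ 4 * (C * (n : ℝ) ^ (r + s * ω - (1 - δ))) := by
            have := hkl.2.2
            gcongr
        _ = (n : ℝ) ^ r * (4 * C * (n : ℝ) ^ (s * ω - (1 - δ))) := by
            rw [add_sub_assoc, Real.rpow_add hx, Real.rpow_natCast]; ring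
        _ ≤ (n : ℝ) ^ r * ((n : ℝ) ^ ((s : ℝ) * (1 - δ)) * κ ^ s) := by gcongr
        _ = (κ * (n : ℝ) ^ (1 - δ)) ^ (s - 1) * (κ * (n : ℝ) ^ ((r : ℝ) + (1 - δ))) := by
            rw [mul_rpow_pow hx, hcast1, Real.rpow_add hx, Real.rpow_natCast]
            have h1 : κ ^ s = κ ^ (s - 1) * κ := by
              rw [← pow_succ, Nat.sub_add_cancel (by omega)]
            have h2 : (n : ℝ) ^ ((s : ℝ) * (1 - δ)) =
                (n : ℝ) ^ ((1 - δ) * ((s : ℝ) - 1)) * (n : ℝ) ^ (1 - δ) := by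
              rw [← Real.rpow_add hx]; congr 1; ring
            rw [h1, h2]; ring
        _ ≤ _ := by gcongr)
  rw [Fintype.card_fin] at hbound
  have hpow2 : (n : ℝ) ^ (r + s - 2) = (n : ℝ) ^ ((r : ℝ) + ((s : ℝ) - 2)) := by
    rw [← Real.rpow_natCast]
    congr 1
    rw [Nat.cast_sub (by omega)]
    push_cast
    ring
  rw [hpow2] at hbound
  have hfinal := chain_bound_numeric (show 2 ≤ s by omega) hx hT0 hκ0 hC0 rfl hg rfl hjk.2.2 hbound
  rw [div_mul_eq_mul_div, div_lt_iff₀ hK₁] at hlarge₂ hlarge₃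
  linarith

/-! ### From hypergraphs without a copy to covered sets of tuples. -/

/-- `t` disjoint sets that are completed to edges by all the vertices of an `s`-set form a copy of
the complete bipartite uniform hypergraph. -/
theorem isContained_of_disjoint {n r s t : ℕ} {H : Hypergraph (Fin n)}
    (hV : H.vertexSet = Set.univ) {S : Finset (Fin n)} (hS : #S = s)
    (X : Fin t → Finset (Fin n)) (hX : ∀ i, #(X i) = r - 1)
    (hdisj : ∀ i j, i ≠ j → Disjoint (X i) (X j))
    (hE : ∀ i, ∀ y ∈ S, y ∉ X i ∧ ((insert y (X i) : Finset (Fin n)) : Set (Fin n)) ∈ H.edgeSet) :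
    (Hypergraph.completeBipartiteUniform r s t).IsContained H := by
  let F : (Fin t × Fin (r - 1)) ⊕ Fin s → Fin n :=
    Sum.elim (fun q => (X q.1).orderEmbOfFin (hX q.1) q.2) (S.orderEmbOfFin hS)
  have hmemX : ∀ i a, (X i).orderEmbOfFin (hX i) a ∈ X i := fun i a => orderEmbOfFin_mem _ _ _
  have hmemS : ∀ a, S.orderEmbOfFin hS a ∈ S := fun a => orderEmbOfFin_mem _ _ _
  have hF : Injective F := by
    refine Injective.sumElim ?_ (S.orderEmbOfFin hS).injective ?_
    · rintro ⟨i, a⟩ ⟨j, b⟩ h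
      dsimp only at h
      have hij : i = j := by
        by_contra hij
        exact disjoint_left.1 (hdisj i j hij) (hmemX i a) (by rw [h]; exact hmemX j b)
      subst hij
      exact Prod.ext rfl (((X i).orderEmbOfFin (hX i)).injective h)
    · rintro ⟨i, a⟩ b h
      exact (hE i _ (hmemS b)).1 (h ▸ hmemX i a)
  refine ⟨fun v => F v.1, fun v w h => Subtype.ext (hF h), fun v => by rw [hV]; trivial, ?_⟩
  rintro e ⟨i, y, rfl⟩
  convert (hE i _ (hmemS y)).2
  ext z
  simp only [Set.mem_image, coe_insert, Set.mem_insert_iff, mem_coe]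
  constructor
  · rintro ⟨⟨v, hv⟩, hve, rfl⟩
    rcases hve with ⟨a, ha⟩ | hve
    · right
      have : v = Sum.inl (i, a) := ha.symm
      subst this
      exact hmemX i a
    · left
      have : v = Sum.inr y := hve
      subst this
      rfl
  · rintro (rfl | hz)
    · exact ⟨⟨Sum.inr y, Set.mem_univ _⟩, Or.inr rfl, rfl⟩
    · have : z ∈ Set.range ((X i).orderEmbOfFin (hX i)) := by
        rw [range_orderEmbOfFin]
        exact hz
      obtain ⟨a, rfl⟩ := this
      exact ⟨⟨Sum.inl (i, a), Set.mem_univ _⟩, Or.inl ⟨a, rfl⟩, rfl⟩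

/-- Take a maximal disjoint family of sets completed by all of `S`. It has fewer than `t` members,
and by maximality every other such set meets its union. -/
theorem exists_cover {n r s t : ℕ} (hr : 2 ≤ r) {H : Hypergraph (Fin n)}
    (hV : H.vertexSet = Set.univ)
    (hfree : ¬ (Hypergraph.completeBipartiteUniform r s t).IsContained H)
    {S : Finset (Fin n)} (hS : #S = s) :
    ∃ c : Finset (Fin n), #c ≤ t * (r - 1) ∧ ∀ X : Finset (Fin n), #X = r - 1 →
      (∀ y ∈ S, y ∉ X ∧ ((insert y X : Finset (Fin n)) : Set (Fin n)) ∈ H.edgeSet) →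
        ∃ x ∈ X, x ∈ c := by
  classical
  let L : Finset (Finset (Fin n)) := univ.filter fun X => #X = r - 1 ∧
    ∀ y ∈ S, y ∉ X ∧ ((insert y X : Finset (Fin n)) : Set (Fin n)) ∈ H.edgeSet
  let fam : Finset (Finset (Finset (Fin n))) :=
    L.powerset.filter fun M => (M : Set (Finset (Fin n))).PairwiseDisjoint id
  obtain ⟨M, hM, hmax⟩ := exists_max_image fam card ⟨∅, by simp [fam]⟩
  obtain ⟨hML, hMd⟩ := mem_filter.1 hM
  rw [mem_powerset] at hML
  have hMt : #M < t := by
    by_contra! hcon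
    refine hfree (isContained_of_disjoint hV hS
      (fun i => (M.equivFin.symm (Fin.castLE hcon i) : Finset (Fin n)))
      (fun i => (mem_filter.1 (hML (Subtype.prop _))).2.1) (fun i j hij => ?_)
      (fun i => (mem_filter.1 (hML (Subtype.prop _))).2.2))
    refine hMd (Subtype.prop _) (Subtype.prop _) fun h => hij ?_
    exact Fin.castLE_injective hcon (M.equivFin.symm.injective (Subtype.ext h))
  refine ⟨M.biUnion id, ?_, fun X hX hXE => ?_⟩
  · refine (card_biUnion_le_card_mul M id (r - 1) fun X hX =>
      (mem_filter.1 (hML hX)).2.1.le).trans ?_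
    exact Nat.mul_le_mul_right _ hMt.le
  · by_contra! hcon
    have hXM : X ∉ M := by
      intro h
      obtain ⟨x, hx⟩ : X.Nonempty := card_pos.1 (by omega)
      exact hcon x hx (mem_biUnion.2 ⟨X, h, hx⟩)
    have hins : insert X M ∈ fam := by
      refine mem_filter.2 ⟨mem_powerset.2 (insert_subset (mem_filter.2 ⟨mem_univ _, hX, hXE⟩) hML),
        ?_⟩
      rw [coe_insert]
      refine hMd.insert fun Y hY _ => disjoint_left.2 fun x hx hxY => ?_
      exact hcon x hx (mem_biUnion.2 ⟨Y, hY, hxY⟩)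
    have := hmax _ hins
    rw [card_insert_of_notMem hXM] at this
    omega

theorem exists_covered {n r s t : ℕ} (hr : 2 ≤ r) (hs : 1 ≤ s) {H : Hypergraph (Fin n)}
    (hV : H.vertexSet = Set.univ) (hU : H.IsUniform r)
    (hfree : ¬ (Hypergraph.completeBipartiteUniform r s t).IsContained H) :
    ∃ cov : Finset (Fin n) → Finset (Fin n), (∀ S, #(cov S) ≤ t * (r - 1)) ∧
      ∃ G : Finset (Fin r → Fin n), Covered s cov G ∧ H.edgeSet.ncard ≤ #G := by
  classical
  have hch : ∀ S : Finset (Fin n), ∃ c : Finset (Fin n), #c ≤ t * (r - 1) ∧ (#S = s →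
      ∀ X : Finset (Fin n), #X = r - 1 →
        (∀ y ∈ S, y ∉ X ∧ ((insert y X : Finset (Fin n)) : Set (Fin n)) ∈ H.edgeSet) →
          ∃ x ∈ X, x ∈ c) := by
    intro S
    by_cases hS : #S = s
    · obtain ⟨c, hc, h⟩ := exists_cover hr hV hfree hS
      exact ⟨c, hc, fun _ => h⟩
    · exact ⟨∅, by simp, fun h => absurd h hS⟩
  choose cov hcov hcover using hch
  let G : Finset (Fin r → Fin n) := univ.filter fun f => Injective f ∧ Set.range f ∈ H.edgeSet
  refine ⟨cov, hcov, G, ?_, ?_⟩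
  · intro i f S hS hf
    have hf' : ∀ a, Injective (update f i (S a)) ∧ Set.range (update f i (S a)) ∈ H.edgeSet :=
      fun a => (mem_filter.1 (hf a)).2
    have hne : ∀ a j, j ≠ i → f j ≠ S a := by
      intro a j hj h
      refine hj ((hf' a).1 ?_)
      rw [update_of_ne hj, update_self, h]
    have hinj : Set.InjOn f (univ.erase i : Finset (Fin r)) := by
      intro j hj j' hj' h
      simp only [coe_erase, coe_univ, Set.mem_sdiff, Set.mem_univ, Set.mem_singleton_iff,
        true_and] at hj hj'
      refine (hf' ⟨0, hs⟩).1 ?_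
      rw [update_of_ne hj, update_of_ne hj', h]
    obtain ⟨x, hx, hxc⟩ := hcover (univ.image S) (by
        rw [card_image_of_injective _ hS, card_univ, Fintype.card_fin])
      ((univ.erase i).image f) (by
        rw [card_image_of_injOn hinj, card_erase_of_mem (mem_univ i), card_univ,
          Fintype.card_fin])
      (by
        intro y hy
        obtain ⟨a, -, rfl⟩ := mem_image.1 hy
        refine ⟨fun h => ?_, ?_⟩
        · obtain ⟨j, hj, hjS⟩ := mem_image.1 h
          exact hne a j (ne_of_mem_erase hj) hjS
        · convert (hf' a).2
          ext z
          simp only [coe_insert, coe_image, coe_erase, coe_univ, Set.mem_insert_iff, Set.mem_image,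
            Set.mem_sdiff, Set.mem_univ, Set.mem_singleton_iff, true_and, Set.mem_range]
          constructor
          · rintro (rfl | ⟨j, hj, rfl⟩)
            · exact ⟨i, update_self ..⟩
            · exact ⟨j, update_of_ne hj ..⟩
          · rintro ⟨j, rfl⟩
            by_cases hj : j = i
            · subst hj
              left
              rw [update_self]
            · right
              exact ⟨j, hj, (update_of_ne hj ..).symm⟩)
    obtain ⟨j, hj, rfl⟩ := mem_image.1 hx
    exact ⟨j, ne_of_mem_erase hj, hxc⟩
  · have hsub : H.edgeSet ⊆ (fun f : Fin r → Fin n => Set.range f) '' (G : Set (Fin r → Fin n)) := by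
      intro e he
      have hcard : #e.toFinset = r := by
        have h1 := hU e he
        rw [Set.encard_eq_coe_toFinset_card] at h1
        exact_mod_cast h1
      have hrange : Set.range (e.toFinset.orderEmbOfFin hcard) = e := by
        rw [range_orderEmbOfFin, Set.coe_toFinset]
      refine ⟨e.toFinset.orderEmbOfFin hcard, ?_, hrange⟩
      refine mem_coe.2 (mem_filter.2 ⟨mem_univ _, (e.toFinset.orderEmbOfFin hcard).injective, ?_⟩)
      rwa [hrange]
    calc H.edgeSet.ncard ≤ _ := Set.ncard_le_ncard hsub (Set.toFinite _)
      _ ≤ (G : Set (Fin r → Fin n)).ncard := Set.ncard_image_le (Set.toFinite _)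
      _ = #G := Set.ncard_coe_finset G

/-! ### The choice of `ε`. -/

/-- With `q = s - 1`, the difference of the two sides is at most `-(1 - 1 / q) + ε * (2 * q ^ 2 + 14
* q + 25)`. Here `1 - 1 / q` is at least 1/2, and `6 * (q + 3) ^ 2` exceeds twice the quadratic. -/
theorem exponent_key {q ε δ η : ℝ} (hq : 2 ≤ q) (hε : ε = 1 / (6 * (q + 3) ^ 2))
    (hδ : δ = 1 / q + ε) (hη : η ≤ 12 * ε) :
    q * ((q - 1) * δ) + (q + 2) * ((q - 1) * δ + η) < (2 * q + 3) * (1 - δ) := by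
  have hq0 : 0 < q := by linarith
  have hε1 : ε * (6 * (q + 3) ^ 2) = 1 := by
    rw [hε]; field_simp
  have hε0 : 0 < ε := by rw [hε]; positivity
  obtain ⟨a, ha⟩ : ∃ a, a = 1 / q := ⟨_, rfl⟩
  have haq : a * q = 1 := by rw [ha]; field_simp
  have ha2 : a ≤ 1 / 2 := by rw [ha]; gcongr
  rw [← ha] at hδ
  have h1 : (q + 2) * η ≤ (q + 2) * (12 * ε) := by gcongr
  have h2 : ε * (2 * q ^ 2 + 14 * q + 25) < 1 / 2 := by nlinarith
  have h3 : q * ((q - 1) * δ) + (q + 2) * ((q - 1) * δ + η) - (2 * q + 3) * (1 - δ) =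
      -(1 - a) + ε * (2 * q ^ 2 + 2 * q + 1) + (q + 2) * η := by
    rw [hδ]
    linear_combination (2 * q + 2) * haq
  nlinarith

/-- The leftover `1 / q ^ 4` costs at most `10 * ε`, the terms in `ε / q`, `ε / q ^ 2`, `ε / q ^ 3`
together at most `ε`, and the last summand one more. -/
theorem exponent_iterate {q ε : ℝ} (hq : 2 ≤ q) (hε : ε = 1 / (6 * (q + 3) ^ 2)) :
    ((((1 / q + ε) / q + ε) / q + ε) / q + ε) ≤ 12 * ε := by
  have hq0 : 0 < q := by linarith
  have hε1 : ε * (6 * (q + 3) ^ 2) = 1 := by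
    rw [hε]; field_simp
  have hε0 : 0 < ε := by rw [hε]; positivity
  have h1 : 1 ≤ 10 * q ^ 4 * ε := by
    have h2 : 6 * (q + 3) ^ 2 ≤ 10 * q ^ 4 := by
      have : 4 ≤ q ^ 2 := by nlinarith
      nlinarith
    nlinarith
  have h2 : (((1 / q + ε) / q + ε) / q + ε) / q + ε =
      (1 + ε * q + ε * q ^ 2 + ε * q ^ 3) / q ^ 4 + ε := by
    field_simp
  rw [h2]
  have h3 : (1 + ε * q + ε * q ^ 2 + ε * q ^ 3) / q ^ 4 ≤ 11 * ε := by
    rw [div_le_iff₀ (by positivity)]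
    have h4 : q + q ^ 2 + q ^ 3 ≤ q ^ 4 := by
      have h5 : 0 ≤ (q - 2) * (q ^ 3 + q ^ 2 + q) := by
        have : 0 ≤ q - 2 := by linarith
        positivity
      nlinarith
    have h5 : ε * (q + q ^ 2 + q ^ 3) ≤ ε * q ^ 4 := by gcongr
    linarith
  linarith

end TupleHypergraph

theorem theorem1p1 (s : ℕ) (hs : 3 ≤ s) :
    ∃ ε : ℝ, 0 < ε ∧ ε = 1 / (6 * ((s : ℝ) + 2) ^ 2) ∧
      ∀ r : ℕ, 3 ≤ r → Odd r → ∀ t : ℕ, 1 ≤ t →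
        (fun n : ℕ =>
          (Hypergraph.turanNumber r n (Hypergraph.completeBipartiteUniform r s t) : ℝ))
          =O[Filter.atTop]
        (fun n : ℕ => (n : ℝ) ^ ((r : ℝ) - 1 / ((s : ℝ) - 1) - ε)) := by
  refine ⟨1 / (6 * ((s : ℝ) + 2) ^ 2), by positivity, rfl, fun r hr hodd t ht => ?_⟩
  have hs' : (3 : ℝ) ≤ s := by exact_mod_cast hs
  obtain ⟨q, hq⟩ : ∃ q : ℝ, q = (s : ℝ) - 1 := ⟨_, rfl⟩
  have hq2 : 2 ≤ q := by linarith
  have hsq : (s : ℝ) = q + 1 := by linarith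
  obtain ⟨ε, hε⟩ : ∃ ε : ℝ, ε = 1 / (6 * ((s : ℝ) + 2) ^ 2) := ⟨_, rfl⟩
  have hε' : ε = 1 / (6 * (q + 3) ^ 2) := by rw [hε, hsq]; ring_nf
  have hε0 : 0 < ε := by rw [hε]; positivity
  have hεs : ε ≤ 1 / 6 := by
    rw [hε]
    refine one_div_le_one_div_of_le (by norm_num) ?_
    nlinarith
  obtain ⟨δ, hδ⟩ : ∃ δ : ℝ, δ = 1 / q + ε := ⟨_, rfl⟩
  have hqinv : 1 / q ≤ 1 / 2 := by gcongr
  have hqq : q * (1 / q) = 1 := by field_simp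
  have hδ1 : δ < 1 := by linarith
  have hqδ : q * δ - 1 = q * ε := by rw [hδ]; linear_combination hqq
  have hδ0 : 0 < δ := by rw [hδ]; positivity
  have hT : 1 ≤ t * (r - 1) := Nat.mul_pos ht (by omega)
  -- As `q * δ - 1 = q * ε`, the recursion contracts `η` by the factor `1 / q` and adds `ε`.
  have step : ∀ η : ℝ, 0 ≤ η → TupleHypergraph.PairsBound r s (t * (r - 1)) δ η →
      TupleHypergraph.PairsBound r s (t * (r - 1)) δ (η / q + ε) := fun η hη h =>
    h.step hr (by omega) hT hδ1 (by positivity) (by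
      rw [← hq]
      field_simp
      linear_combination -hqδ)
  -- Three rounds starting from `δ = 1 / q + ε` give exactly the expression in `exponent_iterate`.
  have hbound := step _ (by positivity) (step _ (by positivity) (step δ hδ0.le
    (TupleHypergraph.pairsBound_self r s (t * (r - 1)) δ)))
  have hcard := hbound.card_lt hodd hs hT hδ1 (by rw [← hq]; nlinarith) (by positivity) rfl (by
    have := TupleHypergraph.exponent_key hq2 hε' hδ
      (hδ ▸ TupleHypergraph.exponent_iterate hq2 hε')
    rw [hsq]
    linarith)
  rw [← hε, ← hq]
  refine Asymptotics.IsBigO.of_bound 1 ?_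
  filter_upwards [hcard] with n hcard
  rw [one_mul, Real.norm_of_nonneg (Nat.cast_nonneg _), Real.norm_of_nonneg (by positivity)]
  have hexp : (r : ℝ) - 1 / q - ε = r - δ := by rw [hδ]; ring
  rw [hexp]
  rcases (Hypergraph.freeEdgeCounts r n
    (Hypergraph.completeBipartiteUniform r s t)).eq_empty_or_nonempty with he | hne
  -- The supremum of the empty set is 0, so non-emptiness need not be shown.
  · rw [Hypergraph.turanNumber, he]
    simp only [csSup_empty, bot_eq_zero', Nat.cast_zero]
    positivity
  · obtain ⟨H, hV, hU, hfree, hm⟩ := Nat.sSup_mem hne (Hypergraph.bddAbove_freeEdgeCounts r n _)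
    obtain ⟨cov, hcov, G, hG, hle⟩ :=
      TupleHypergraph.exists_covered (by omega) (by omega) hV hU hfree
    rw [Hypergraph.turanNumber, ← hm]
    exact le_trans (by exact_mod_cast hle) (hcard cov hcov G hG).le
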